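/- Let $G=(V,E)$ be a finite connected bridgeless cubic multigraph on $n=|V|$ vertices (parallel edges are allowed, loops are not). Then $G$ has a cycle cover, that is, a set of pairwise vertex-disjoint cycles of $G$ that together contain all vertices of $G$ (a cycle is a closed path without repeated vertices; a pair of parallel edges is a cycle of length $2$), consisting of at most $\lfloor n/6+2/3\rfloor$ cycles. More precisely, there are a perfect matching $M^*$ of $G$ and a spanning tree $T^*$ of $G$ with $|M^*\cap T^*|\le n/6-1/3$ such that $E\setminus M^*$ is the edge set of a cycle cover of $G$ with at most $\lfloor n/6+2/3\rfloor$ cycles. -/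

import Mathlib

/-!
Multigraphs are Mathlib's `Graph α β` (vertices in `α`, edges in `β`, parallel edges allowed);
`G.Loopless` says that there are no loops.
-/

namespace Graph

variable {α β : Type*}

/-- Every vertex of the (loopless) multigraph `G` is incident with exactly three edges. -/
def IsCubic (G : Graph α β) : Prop :=
  ∀ v, v ∈ G.vertexSet → {e | G.Inc e v}.ncard = 3

/-- There is a walk (possibly of length zero) from `x` to `y`. -/
def Reachable (G : Graph α β) (x y : α) : Prop :=
  Relation.ReflTransGen G.Adj x y

/-- `G` is connected: it has a vertex, and any two vertices are joined by a walk. -/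
def IsConnected (G : Graph α β) : Prop :=
  G.vertexSet.Nonempty ∧ ∀ x y, x ∈ G.vertexSet → y ∈ G.vertexSet → G.Reachable x y

/-- An edge `e` is a bridge if its ends lie in different components once `e` is deleted. -/
def IsBridge (G : Graph α β) (e : β) : Prop :=
  ∃ x y, G.IsLink e x y ∧ ¬ (G.deleteEdges {e}).Reachable x y

/-- `G` has no bridge. -/
def IsBridgeless (G : Graph α β) : Prop :=
  ∀ e, ¬ G.IsBridge e

/-- The graph `C` is a cycle: for some `k ≥ 1` its vertices are `v 0, …, v (k - 1)` and its edges are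
`e 0, …, e (k - 1)`, without repetition, where `e i` joins `v i` and `v (i + 1)`, indices mod `k`.
Thus `k = 2` is a pair of parallel edges, and `k = 1` is a loop. -/
def IsCycle (C : Graph α β) : Prop :=
  ∃ k : ℕ, 1 ≤ k ∧ ∃ (v : ZMod k → α) (e : ZMod k → β),
    Function.Injective v ∧ Function.Injective e ∧
    C.vertexSet = Set.range v ∧ C.edgeSet = Set.range e ∧
    ∀ i, C.IsLink (e i) (v i) (v (i + 1))

/-- A cycle cover (2-factor) of `G`: a set of pairwise vertex-disjoint cycles of `G` that together
contain all vertices of `G`. -/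
structure IsCycleCover (G : Graph α β) (𝒞 : Finset (Graph α β)) : Prop where
  le : ∀ C ∈ 𝒞, C ≤ G
  isCycle : ∀ C ∈ 𝒞, C.IsCycle
  disjoint : ∀ C ∈ 𝒞, ∀ D ∈ 𝒞, C ≠ D → Disjoint C.vertexSet D.vertexSet
  cover : ∀ v ∈ G.vertexSet, ∃ C ∈ 𝒞, v ∈ C.vertexSet

/-- A set of edges of the (loopless) multigraph `G` meeting every vertex exactly once. -/
structure IsPerfectMatching (G : Graph α β) (M : Set β) : Prop where
  subset : M ⊆ G.edgeSet
  existsUnique_inc : ∀ v ∈ G.vertexSet, ∃! e, e ∈ M ∧ G.Inc e v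

/-- A set `T` of edges of `G` such that the graph with all vertices of `G` and with edge set `T` is
connected and contains no cycle. -/
structure IsSpanningTree (G : Graph α β) (T : Set β) : Prop where
  subset : T ⊆ G.edgeSet
  isConnected : (G.restrict T).IsConnected
  acyclic : ∀ C : Graph α β, C ≤ G.restrict T → ¬ C.IsCycle

end Graph

/-!
The proof combines two facts about a connected bridgeless cubic multigraph `G` with `n` vertices.

*Few edges are essential.* There is a set `N` of at most `n / 2 - 1` edges such that deleting any
set of pairwise vertex-disjoint edges outside `N` leaves `G` connected
(`CubicCover.exists_essential_edges_univ`). It comes from a depth-first search. When the search has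
arrived at a vertex `v` and `C` is a component of the unvisited rest of the current part, all edges
leaving `C` lead to `v` or to vertices visited earlier. If at least two edges join `v` to `C`, a set
of vertex-disjoint edges cannot contain all of them, and none of them is essential; otherwise the
single edge from `v` to `C` is put into `N`. The search continues in `C`, starting at a neighbour of
`v`. Induction gives `2 |N| + 4 ≤ |S| + |δ(S)|` for each part `S` that is searched from a vertex
with an edge leaving `S`. As `G` has no bridge, the search does not branch at the root, whose removal
leaves a part with `n - 1` vertices and three leaving edges.

*A perfect matching can avoid most of `N`.* Every odd cut has at least three edges, so by Edmonds'
theorem the constant `1 / 3` is a convex combination of perfect matchings, and some perfect matching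
`M` has `|M ∩ N| ≤ |N| / 3 ≤ n / 6 - 1 / 3`. Edmonds' theorem is
`CubicCover.IsFracMatching.hasCheapMatching`. It is proved by induction, contracting the two sides
of a tight odd cut if there is one, and otherwise peeling off a perfect matching, which
exists by Tutte's theorem.

Then `E \ (M \ N)` is connected, and it contains a spanning tree `T`, for which
`M ∩ T ⊆ M ∩ N`. The components of the 2-regular graph with edge set `E \ M` are cycles
(`Graph.isCycle_induce_reachable`). Adding the edges in `M ∩ N` makes this graph connected, so it
has at most `|M ∩ N| + 1` components (`Graph.ncard_component_le`).
-/

/-! ### Edge cuts and fractional perfect matchings -/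

namespace CubicCover

open Finset

variable {V β : Type*} [DecidableEq V] [Fintype β]

/-- The edge cut of the vertex set `U` in the multigraph whose edge `e` has the ends `s e` and
`t e`: the edges with exactly one end in `U`. For `U = {v}` these are the edges at `v` that are
not loops. -/
def cut (s t : β → V) (U : Finset V) : Finset β :=
  univ.filter fun e => ¬ (s e ∈ U ↔ t e ∈ U)

theorem mem_cut {s t : β → V} {U : Finset V} {e : β} :
    e ∈ cut s t U ↔ ¬ (s e ∈ U ↔ t e ∈ U) := by
  simp [cut]

/-- A point of Edmonds' perfect matching polytope of the multigraph with vertex set `A` whose edge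
`e` has the ends `s e` and `t e`. Loops are allowed, but have weight zero. -/
structure IsFracMatching (A : Finset V) (s t : β → V) (x : β → ℝ) : Prop where
  s_mem : ∀ e, s e ∈ A
  t_mem : ∀ e, t e ∈ A
  nonneg : ∀ e, 0 ≤ x e
  loop : ∀ e, s e = t e → x e = 0
  star : ∀ v ∈ A, ∑ e ∈ cut s t {v}, x e = 1
  odd : ∀ U, U ⊆ A → Odd U.card → 1 ≤ ∑ e ∈ cut s t U, x e

/-- `M` contains exactly one non-loop edge at each vertex of `A`. -/
def IsMatchingOn [DecidableEq β] (A : Finset V) (s t : β → V) (M : Finset β) : Prop :=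
  ∀ v ∈ A, (cut s t {v} ∩ M).card = 1

/-- For every cost function there is a perfect matching inside the support of `x` that costs at
most as much as `x` does. By duality, this amounts to `x` being a convex combination of
perfect matchings. -/
def HasCheapMatching [DecidableEq β] (A : Finset V) (s t : β → V) (x : β → ℝ) : Prop :=
  ∀ c : β → ℝ, ∃ M : Finset β, (∀ e ∈ M, 0 < x e) ∧ IsMatchingOn A s t M ∧
    ∑ e ∈ M, c e ≤ ∑ e, x e * c e

variable {A : Finset V} {s t : β → V} {x : β → ℝ}

theorem cut_sdiff (hs : ∀ e, s e ∈ A) (ht : ∀ e, t e ∈ A) (U : Finset V) :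
    cut s t (A \ U) = cut s t U := by
  ext e
  simp only [mem_cut, mem_sdiff, hs e, ht e, true_and]
  tauto

theorem IsFracMatching.even_card (h : IsFracMatching A s t x) : Even A.card := by
  by_contra hA
  have h1 := h.odd A subset_rfl (Nat.not_even_iff_odd.1 hA)
  have h2 : cut s t A = ∅ := by
    ext e
    simp [mem_cut, h.s_mem e, h.t_mem e]
  rw [h2] at h1
  norm_num at h1

theorem IsFracMatching.odd_card_sdiff (h : IsFracMatching A s t x) {U : Finset V} (hU : U ⊆ A)
    (hodd : Odd U.card) : Odd (A \ U).card := by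
  have h1 := card_sdiff_add_card_eq_card hU
  have h2 := h.even_card
  rw [← h1] at h2
  by_contra h3
  rw [Nat.not_odd_iff_even] at h3
  exact (Nat.not_even_iff_odd.2 hodd) ((Nat.even_add.1 h2).1 h3)

theorem two_le_card_of_two_le_card_cut [DecidableEq β] {M : Finset β}
    (hM : IsMatchingOn A s t M) {U : Finset V} (hU : U ⊆ A) (h2 : 2 ≤ (cut s t U ∩ M).card) :
    2 ≤ U.card := by
  by_contra hlt
  rcases Nat.lt_or_ge U.card 1 with h | h
  · have : U = ∅ := card_eq_zero.1 (by omega)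
    subst this
    simp [cut] at h2
  · obtain ⟨v, rfl⟩ := card_eq_one.1 (show U.card = 1 by omega)
    have := hM v (hU (mem_singleton_self v))
    omega

theorem sum_biUnion_le_sum_sum {ι γ : Type*} [DecidableEq γ] {x : γ → ℝ} (hx : ∀ e, 0 ≤ x e)
    (u : Finset ι) (f : ι → Finset γ) :
    ∑ e ∈ u.biUnion f, x e ≤ ∑ v ∈ u, ∑ e ∈ f v, x e := by
  classical
  induction u using Finset.induction_on with
  | empty => simp
  | insert a u ha ih =>
    rw [biUnion_insert, sum_insert ha]
    have h1 := sum_union_inter (s₁ := f a) (s₂ := u.biUnion f) (f := x)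
    have h2 : 0 ≤ ∑ e ∈ f a ∩ u.biUnion f, x e := sum_nonneg fun e _ => hx e
    linarith

/-- Disjoint odd sets `comp K` whose edges of positive weight all lead to `u` number at most `|u|`:
each receives weight at least one from `u`, while `u` sends out weight at most `|u|`. -/
theorem IsFracMatching.card_le_of_odd_comps (h : IsFracMatching A s t x) {ι : Type*}
    (odd : Finset ι) (comp : ι → Finset V) (u : Finset V) (hu : u ⊆ A)
    (hsub : ∀ K ∈ odd, comp K ⊆ A) (hodd : ∀ K ∈ odd, Odd (comp K).card)
    (hnotu : ∀ K ∈ odd, ∀ a ∈ comp K, a ∉ u)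
    (huniq : ∀ K ∈ odd, ∀ L ∈ odd, ∀ a ∈ comp K, a ∈ comp L → K = L)
    (key : ∀ K ∈ odd, ∀ e, 0 < x e → s e ∈ comp K → t e ∉ comp K → t e ∈ u)
    (key' : ∀ K ∈ odd, ∀ e, 0 < x e → t e ∈ comp K → s e ∉ comp K → s e ∈ u) :
    odd.card ≤ u.card := by
  classical
  let P : Finset β := univ.filter fun e => 0 < x e
  have h1 : (odd.card : ℝ) ≤ ∑ K ∈ odd, ∑ e ∈ cut s t (comp K) ∩ P, x e := by
    rw [card_eq_sum_ones, Nat.cast_sum]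
    refine sum_le_sum fun K hK => ?_
    have h2 := h.odd (comp K) (hsub K hK) (hodd K hK)
    have h3 : ∑ e ∈ cut s t (comp K) ∩ P, x e = ∑ e ∈ cut s t (comp K), x e := by
      refine sum_subset inter_subset_left fun e he he' => ?_
      have : ¬ 0 < x e := fun hpos => he' (mem_inter.2 ⟨he, by simp [P, hpos]⟩)
      exact le_antisymm (not_lt.1 this) (h.nonneg e)
    rw [h3]
    simpa using h2
  have hdisj : (odd : Set ι).PairwiseDisjoint (fun K => cut s t (comp K) ∩ P) := by
    intro K hK L hL hKL
    rw [Function.onFun, disjoint_left]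
    intro e he he'
    rw [mem_inter, mem_cut] at he he'
    obtain ⟨heK, hpos⟩ := he
    obtain ⟨heL, -⟩ := he'
    replace hpos : 0 < x e := (mem_filter.1 hpos).2
    by_cases hsK : s e ∈ comp K
    · have htK : t e ∉ comp K := by tauto
      have htu := key K hK e hpos hsK htK
      have htL : t e ∉ comp L := fun h' => hnotu L hL _ h' htu
      have hsL : s e ∈ comp L := by tauto
      exact hKL (huniq K hK L hL _ hsK hsL)
    · have htK : t e ∈ comp K := by tauto
      have hsu := key' K hK e hpos htK hsK
      have hsL : s e ∉ comp L := fun h' => hnotu L hL _ h' hsu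
      have htL : t e ∈ comp L := by tauto
      exact hKL (huniq K hK L hL _ htK htL)
  have h2 : odd.biUnion (fun K => cut s t (comp K) ∩ P) ⊆ u.biUnion fun v => cut s t {v} := by
    intro e he
    rw [mem_biUnion] at he ⊢
    obtain ⟨K, hK, he⟩ := he
    rw [mem_inter, mem_cut] at he
    obtain ⟨heK, hpos⟩ := he
    replace hpos : 0 < x e := (mem_filter.1 hpos).2
    by_cases hsK : s e ∈ comp K
    · have htK : t e ∉ comp K := by tauto
      refine ⟨_, key K hK e hpos hsK htK, mem_cut.2 fun h' => htK ?_⟩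
      have := mem_singleton.1 (h'.2 (mem_singleton_self _))
      rwa [← this]
    · have htK : t e ∈ comp K := by tauto
      refine ⟨_, key' K hK e hpos htK hsK, mem_cut.2 fun h' => hsK ?_⟩
      have := mem_singleton.1 (h'.1 (mem_singleton_self _))
      rwa [← this]
  have h3 : ∑ K ∈ odd, ∑ e ∈ cut s t (comp K) ∩ P, x e ≤ u.card := by
    rw [← sum_biUnion hdisj]
    calc _ ≤ ∑ e ∈ u.biUnion fun v => cut s t {v}, x e :=
          sum_le_sum_of_subset_of_nonneg h2 fun e _ _ => h.nonneg e
      _ ≤ ∑ v ∈ u, ∑ e ∈ cut s t {v}, x e := sum_biUnion_le_sum_sum h.nonneg _ _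
      _ = _ := by
          rw [sum_congr rfl fun v hv => h.star v (hu hv)]
          simp
  exact_mod_cast h1.trans h3

/-- The simple graph on `A` of the pairs that are joined by an edge of positive weight. -/
def supportGraph (A : Finset V) (s t : β → V) (x : β → ℝ) : SimpleGraph A where
  Adj v w := v ≠ w ∧ ∃ e, 0 < x e ∧ s(s e, t e) = s((v : V), (w : V))
  symm := ⟨fun _ _ ⟨h1, e, h2, h3⟩ => ⟨h1.symm, e, h2, h3.trans Sym2.eq_swap⟩⟩
  loopless := ⟨fun _ hv => hv.1 rfl⟩

theorem IsFracMatching.not_isTutteViolator (h : IsFracMatching A s t x) (u : Set A) :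
    ¬ (supportGraph A s t x).IsTutteViolator u := by
  classical
  intro hu
  unfold SimpleGraph.IsTutteViolator at hu
  generalize hD : (⊤ : (supportGraph A s t x).Subgraph).deleteVerts u = D at hu
  have hDv : ∀ a : A, a ∈ D.verts ↔ a ∉ u := by simp [← hD]
  have hDadj : ∀ a b : A, a ∉ u → b ∉ u → (supportGraph A s t x).Adj a b → D.Adj a b := by
    intro a b ha hb hab
    simp [← hD, ha, hb, hab]
  let comp : D.coe.ConnectedComponent → Finset V := fun K =>
    A.filter fun a => ∃ (ha : a ∈ A) (hb : (⟨a, ha⟩ : A) ∈ D.verts),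
      D.coe.connectedComponentMk ⟨⟨a, ha⟩, hb⟩ = K
  have hcomp : ∀ K a, a ∈ comp K ↔ ∃ (ha : a ∈ A) (hb : (⟨a, ha⟩ : A) ∈ D.verts),
      D.coe.connectedComponentMk ⟨⟨a, ha⟩, hb⟩ = K := by
    intro K a
    simp only [comp, mem_filter, and_iff_right_iff_imp]
    exact fun h => h.1
  have hcomp_card : ∀ K, (comp K).card = K.supp.ncard := by
    intro K
    have h1 : ((comp K : Finset V) : Set V) = (fun z : D.verts => ((z : A) : V)) '' K.supp := by
      ext a
      simp only [mem_coe, hcomp, Set.mem_image, SimpleGraph.ConnectedComponent.mem_supp_iff]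
      constructor
      · rintro ⟨ha, hb, hK⟩
        exact ⟨⟨⟨a, ha⟩, hb⟩, hK, rfl⟩
      · rintro ⟨z, hz, rfl⟩
        exact ⟨z.1.2, z.2, hz⟩
    rw [← Set.ncard_coe_finset, h1, Set.ncard_image_of_injective]
    intro a b hab
    exact Subtype.ext (Subtype.ext hab)
  have key : ∀ K a b (hb : b ∈ A), a ∈ comp K → b ∉ comp K → a ≠ b →
      (∃ e, 0 < x e ∧ s(s e, t e) = s(a, b)) →
      b ∈ u.toFinset.map ⟨Subtype.val, Subtype.val_injective⟩ := by
    intro K a b hb ha hbK hab he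
    obtain ⟨haA, haD, hK⟩ := (hcomp K a).1 ha
    by_contra hbu
    have hbu' : (⟨b, hb⟩ : A) ∉ u := fun h' => hbu (by simpa using ⟨hb, h'⟩)
    refine hbK ((hcomp K b).2 ⟨hb, (hDv _).2 hbu', ?_⟩)
    rw [← hK]
    refine SimpleGraph.ConnectedComponent.sound (SimpleGraph.Adj.reachable ?_)
    exact (hDadj _ _ ((hDv _).1 haD) hbu' ⟨fun h' => hab (congrArg Subtype.val h'), he⟩).symm
  have hfin : D.coe.oddComponents.Finite := Set.toFinite _
  have h1 := h.card_le_of_odd_comps hfin.toFinset comp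
    (u.toFinset.map ⟨Subtype.val, Subtype.val_injective⟩)
    (fun a ha => by
      obtain ⟨b, -, rfl⟩ := mem_map.1 ha
      exact b.2)
    (fun K _ => filter_subset _ _)
    (fun K hK => by
      rw [hcomp_card]
      exact hfin.mem_toFinset.1 hK)
    (fun K _ a ha hau => by
      obtain ⟨haA, haD, -⟩ := (hcomp K a).1 ha
      obtain ⟨b, hb, hba⟩ := mem_map.1 hau
      subst hba
      exact (hDv _).1 haD (Set.mem_toFinset.1 hb))
    (fun K _ L _ a haK haL => by
      obtain ⟨_, _, h1⟩ := (hcomp K a).1 haK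
      obtain ⟨_, _, h2⟩ := (hcomp L a).1 haL
      rw [← h1, ← h2])
    (fun K _ e he hs ht => key K _ _ (h.t_mem e) hs ht (fun h' => ht (h' ▸ hs)) ⟨e, he, rfl⟩)
    (fun K _ e he hs ht => key K _ _ (h.s_mem e) hs ht (fun h' => ht (h' ▸ hs))
      ⟨e, he, Sym2.eq_swap⟩)
  rw [card_map, ← Set.ncard_eq_toFinset_card _ hfin, ← Set.ncard_eq_toFinset_card'] at h1
  omega

/-- Tutte's theorem applied to the support of a fractional perfect matching. -/
theorem IsFracMatching.exists_isMatchingOn [DecidableEq β] (h : IsFracMatching A s t x) :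
    ∃ M : Finset β, (∀ e ∈ M, 0 < x e) ∧ IsMatchingOn A s t M := by
  obtain ⟨N, hN⟩ := SimpleGraph.tutte.2 h.not_isTutteViolator
  rw [SimpleGraph.Subgraph.isPerfectMatching_iff] at hN
  have hpick : ∀ z : N.edgeSet, ∃ e, 0 < x e ∧ s(s e, t e) = z.1.map Subtype.val := by
    rintro ⟨z, hz⟩
    induction z with
    | _ v w =>
      rw [SimpleGraph.Subgraph.mem_edgeSet] at hz
      exact (N.adj_sub hz).2
  choose f hf0 hf using hpick
  classical
  refine ⟨univ.image f, ?_, ?_⟩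
  · intro e he
    obtain ⟨z, -, rfl⟩ := mem_image.1 he
    exact hf0 z
  · intro v hv
    obtain ⟨w, hw, hwu⟩ := hN ⟨v, hv⟩
    rw [card_eq_one]
    refine ⟨f ⟨s(⟨v, hv⟩, w), hw⟩, ?_⟩
    have hvw : v ≠ w := fun h' => (N.adj_sub hw).1 (Subtype.ext h')
    ext e
    simp only [mem_inter, mem_image, mem_univ, true_and, mem_singleton, mem_cut]
    constructor
    · rintro ⟨he, ⟨z, hz⟩, rfl⟩
      have h1 := hf ⟨z, hz⟩
      have h2 : v ∈ s(s (f ⟨z, hz⟩), t (f ⟨z, hz⟩)) := by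
        rw [Sym2.mem_iff]
        by_contra hcon
        push Not at hcon
        exact he ⟨fun h' => absurd h'.symm hcon.1, fun h' => absurd h'.symm hcon.2⟩
      rw [h1, Sym2.mem_map] at h2
      obtain ⟨a, ha, hav⟩ := h2
      obtain rfl : a = ⟨v, hv⟩ := Subtype.ext hav
      obtain ⟨b, rfl⟩ := Sym2.mem_iff_exists.1 ha
      obtain rfl := hwu b hz
      rfl
    · rintro rfl
      refine ⟨?_, _, rfl⟩
      have h1 := hf ⟨s(⟨v, hv⟩, w), hw⟩
      rw [Sym2.map_mk, Sym2.eq_iff] at h1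
      rcases h1 with ⟨h1, h2⟩ | ⟨h1, h2⟩
      · rw [h1, h2]
        exact fun h' => hvw (h'.1 rfl).symm
      · rw [h1, h2]
        exact fun h' => hvw (h'.2 rfl).symm

/-! ### Contraction of tight odd cuts -/

/-- The map on vertices that contracts `U` to its representative `u`. -/
def collapse (U : Finset V) (u v : V) : V := if v ∈ U then u else v

/-- The weights after contracting `U`: the edges inside `U` become loops and are given weight
zero. -/
def outsideWeight (s t : β → V) (U : Finset V) (x : β → ℝ) (e : β) : ℝ :=
  if s e ∈ U ∧ t e ∈ U then 0 else x e

section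
variable {U : Finset V} {u : V}

theorem outsideWeight_of_mem_cut {e : β} (he : e ∈ cut s t U) : outsideWeight s t U x e = x e :=
  if_neg fun h => mem_cut.1 he ⟨fun _ => h.2, fun _ => h.1⟩

theorem collapse_of_mem {v : V} (h : v ∈ U) : collapse U u v = u := if_pos h
theorem collapse_of_notMem {v : V} (h : v ∉ U) : collapse U u v = v := if_neg h

/-- The cuts of the contracted graph are the cuts of the original graph that do not split `U`. -/
theorem cut_collapse (hs : ∀ e, s e ∈ A) (ht : ∀ e, t e ∈ A) (W : Finset V) :
    cut (collapse U u ∘ s) (collapse U u ∘ t) W =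
      cut s t (A.filter fun v => collapse U u v ∈ W) := by
  ext e
  simp [mem_cut, hs e, ht e]

/-- The weights of the contracted graph agree with `x` on the cuts that do not split `U`. -/
theorem sum_outsideWeight_cut (W : Finset V) (hUA : U ⊆ A) :
    ∑ e ∈ cut s t (A.filter fun v => collapse U u v ∈ W), outsideWeight s t U x e =
      ∑ e ∈ cut s t (A.filter fun v => collapse U u v ∈ W), x e := by
  refine sum_congr rfl fun e he => if_neg fun h => mem_cut.1 he ?_
  rw [mem_filter, mem_filter, collapse_of_mem h.1, collapse_of_mem h.2]
  simp [hUA h.1, hUA h.2]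

theorem filter_collapse_of_mem {W : Finset V} (hUA : U ⊆ A) (hu : u ∈ U)
    (hW : W ⊆ insert u (A \ U)) (huW : u ∈ W) :
    (A.filter fun v => collapse U u v ∈ W) = W.erase u ∪ U := by
  ext w
  rw [mem_filter, mem_union, mem_erase]
  by_cases hw : w ∈ U
  · simp [collapse_of_mem hw, huW, hw, hUA hw]
  · rw [collapse_of_notMem hw]
    have hwu : w ≠ u := fun h => hw (h ▸ hu)
    have : w ∈ W → w ∈ A := fun h => by
      have := hW h
      rw [mem_insert, mem_sdiff] at this
      exact (this.resolve_left hwu).1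
    tauto

theorem filter_collapse_of_notMem {W : Finset V} (hW : W ⊆ insert u (A \ U)) (huW : u ∉ W) :
    (A.filter fun v => collapse U u v ∈ W) = W := by
  ext w
  rw [mem_filter]
  have h2 : w ∈ W → w ∈ A ∧ w ∉ U := by
    intro hw
    have := hW hw
    rw [mem_insert, mem_sdiff] at this
    exact this.resolve_left fun h' => huW (h' ▸ hw)
  by_cases hw : w ∈ U
  · rw [collapse_of_mem hw]
    tauto
  · rw [collapse_of_notMem hw]
    tauto

theorem cut_collapse_self (hs : ∀ e, s e ∈ A) (ht : ∀ e, t e ∈ A) (hUA : U ⊆ A) (hu : u ∈ U) :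
    cut (collapse U u ∘ s) (collapse U u ∘ t) {u} = cut s t U := by
  rw [cut_collapse hs ht, filter_collapse_of_mem hUA hu (by simp) (mem_singleton_self u)]
  simp

theorem cut_collapse_singleton (hs : ∀ e, s e ∈ A) (ht : ∀ e, t e ∈ A) (hu : u ∈ U) {v : V}
    (hv : v ∈ A \ U) :
    cut (collapse U u ∘ s) (collapse U u ∘ t) {v} = cut s t {v} := by
  rw [cut_collapse hs ht, filter_collapse_of_notMem]
  · simpa using Or.inr (mem_sdiff.1 hv)
  · rw [mem_singleton]
    rintro rfl
    exact (mem_sdiff.1 hv).2 hu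

theorem IsFracMatching.contract (h : IsFracMatching A s t x) (hU : U ⊆ A) (hu : u ∈ U)
    (hodd : Odd U.card) (htight : ∑ e ∈ cut s t U, x e = 1) :
    IsFracMatching (insert u (A \ U)) (collapse U u ∘ s) (collapse U u ∘ t)
      (outsideWeight s t U x) := by
  have hmem : ∀ v ∈ A, collapse U u v ∈ insert u (A \ U) := by
    intro v hv
    by_cases hvU : v ∈ U
    · simp [collapse_of_mem hvU]
    · simp [collapse_of_notMem hvU, hv, hvU]
  have hodd' : ∀ W ⊆ insert u (A \ U), Odd W.card →
      Odd (A.filter fun v => collapse U u v ∈ W).card := by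
    intro W hW hWodd
    by_cases huW : u ∈ W
    · have h2 : Disjoint (W.erase u) U := by
        rw [disjoint_left]
        intro w hw hwU
        obtain ⟨h1, h2⟩ := mem_erase.1 hw
        have := hW h2
        simp [h1, hwU] at this
      rw [filter_collapse_of_mem hU hu hW huW, card_union_of_disjoint h2, card_erase_of_mem huW]
      obtain ⟨a, ha⟩ := hWodd
      obtain ⟨b, hb⟩ := hodd
      exact ⟨a + b, by omega⟩
    · rwa [filter_collapse_of_notMem hW huW]
  have hsum : ∀ W, ∑ e ∈ cut (collapse U u ∘ s) (collapse U u ∘ t) W, outsideWeight s t U x e =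
      ∑ e ∈ cut (collapse U u ∘ s) (collapse U u ∘ t) W, x e := fun W => by
    rw [cut_collapse h.s_mem h.t_mem, sum_outsideWeight_cut W hU]
  refine ⟨fun e => hmem _ (h.s_mem e), fun e => hmem _ (h.t_mem e), ?_, ?_, ?_, ?_⟩
  · intro e
    unfold outsideWeight
    split_ifs
    exacts [le_rfl, h.nonneg e]
  · intro e he
    unfold outsideWeight
    split_ifs with h1
    · rfl
    · apply h.loop
      simp only [Function.comp, collapse] at he
      split_ifs at he with h2 h3 h3
      · exact absurd ⟨h2, h3⟩ h1
      · exact absurd (he ▸ hu) h3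
      · exact absurd (he ▸ hu) h2
      · exact he
  · intro v hv
    rw [hsum]
    rcases mem_insert.1 hv with rfl | hv
    · rw [cut_collapse_self h.s_mem h.t_mem hU hu, htight]
    · rw [cut_collapse_singleton h.s_mem h.t_mem hu hv, h.star v (mem_sdiff.1 hv).1]
  · intro W hW hWodd
    rw [hsum, cut_collapse h.s_mem h.t_mem]
    exact h.odd _ (filter_subset _ _) (hodd' W hW hWodd)

theorem IsMatchingOn.of_contract [DecidableEq β] {M : Finset β} (hs : ∀ e, s e ∈ A)
    (ht : ∀ e, t e ∈ A) (hU : U ⊆ A) (hu : u ∈ U)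
    (hM : IsMatchingOn (insert u (A \ U)) (collapse U u ∘ s) (collapse U u ∘ t) M) :
    IsMatchingOn (A \ U) s t M ∧ (cut s t U ∩ M).card = 1 := by
  constructor
  · intro v hv
    rw [← cut_collapse_singleton hs ht hu hv]
    exact hM v (mem_insert_of_mem hv)
  · rw [← cut_collapse_self hs ht hU hu]
    exact hM u (mem_insert_self _ _)

/-- The information that contracting a tight odd cut carries over from the smaller graph: for
every cost there is a cheap set of edges outside `U` that matches the vertices outside `U` and
uses one edge of the cut. -/
theorem IsFracMatching.exists_outside [DecidableEq β] (h : IsFracMatching A s t x) (hU : U ⊆ A)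
    (hodd : Odd U.card) (hcard : 2 ≤ U.card) (htight : ∑ e ∈ cut s t U, x e = 1)
    (ih : ∀ (A' : Finset V) (s' t' : β → V) (x' : β → ℝ), A'.card < A.card →
      IsFracMatching A' s' t' x' → HasCheapMatching A' s' t' x') (c : β → ℝ) :
    ∃ M : Finset β, (∀ e ∈ M, 0 < x e ∧ ¬ (s e ∈ U ∧ t e ∈ U)) ∧ IsMatchingOn (A \ U) s t M ∧
      (cut s t U ∩ M).card = 1 ∧
      ∑ e ∈ M, c e ≤ ∑ e, outsideWeight s t U x e * c e := by
  obtain ⟨u, hu⟩ : U.Nonempty := card_pos.1 (by omega)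
  have hlt : (insert u (A \ U)).card < A.card := by
    have h1 := card_sdiff_add_card_eq_card hU
    have h2 := card_insert_le u (A \ U)
    omega
  obtain ⟨M, hM0, hM, hMc⟩ := ih _ _ _ _ hlt (h.contract hU hu hodd htight) c
  refine ⟨M, fun e he => ?_, (hM.of_contract h.s_mem h.t_mem hU hu).1,
    (hM.of_contract h.s_mem h.t_mem hU hu).2, hMc⟩
  have := hM0 e he
  unfold outsideWeight at this
  split_ifs at this with h1
  · exact absurd this (lt_irrefl _)
  · exact ⟨this, h1⟩

/-- Gluing along a tight odd cut. Let `α f` be the least cost of a partial matching of one side that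
uses the cut edge `f`. On that side the cost `c - α` is nonnegative for all of these, hence
for the fractional matching too. So charging `α` for the cut edges on the other side, and applying
the induction hypothesis there, costs at most as much as `x` does. -/
theorem IsFracMatching.hasCheapMatching_of_tight [DecidableEq β] (h : IsFracMatching A s t x)
    (hU : U ⊆ A) (hodd : Odd U.card) (hcard : 2 ≤ U.card) (hcard' : 2 ≤ (A \ U).card)
    (htight : ∑ e ∈ cut s t U, x e = 1)
    (ih : ∀ (A' : Finset V) (s' t' : β → V) (x' : β → ℝ), A'.card < A.card →
      IsFracMatching A' s' t' x' → HasCheapMatching A' s' t' x') :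
    HasCheapMatching A s t x := by
  have hcut : cut s t (A \ U) = cut s t U := cut_sdiff h.s_mem h.t_mem U
  have out1 := h.exists_outside sdiff_subset (h.odd_card_sdiff hU hodd) hcard'
    (by rw [hcut, htight]) ih
  have out2 := h.exists_outside hU hodd hcard htight ih
  rw [Finset.sdiff_sdiff_eq_self hU, hcut] at out1
  intro c
  -- The partial matchings of the side `U` that use the cut edge `f`.
  let Q : β → Finset β → Prop := fun f M => (∀ e ∈ M, 0 < x e ∧ ¬ (s e ∈ A \ U ∧ t e ∈ A \ U)) ∧
    IsMatchingOn U s t M ∧ cut s t U ∩ M = {f}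
  have hQ : ∀ f, f ∈ cut s t U → 0 < x f → ∃ M, Q f M := by
    intro f hf hxf
    obtain ⟨M, h1, h2, h3, h4⟩ := out1 fun e => if e = f then -1 else 0
    have hsum : ∑ e, outsideWeight s t (A \ U) x e * (if e = f then -1 else 0) = - x f := by
      rw [sum_eq_single f]
      · rw [outsideWeight_of_mem_cut (hcut ▸ hf), if_pos rfl, mul_neg_one]
      · intro b _ hb
        simp [hb]
      · simp
    rw [hsum] at h4
    have hfM : f ∈ M := by
      by_contra hfM
      rw [sum_eq_zero fun e he => if_neg (ne_of_mem_of_not_mem he hfM)] at h4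
      linarith
    refine ⟨M, h1, h2, ?_⟩
    obtain ⟨g, hg⟩ := card_eq_one.1 h3
    have : f ∈ cut s t U ∩ M := mem_inter.2 ⟨hf, hfM⟩
    rw [hg, mem_singleton] at this
    rw [hg, this]
  have hmin : ∀ f, ∃ M, (f ∈ cut s t U → 0 < x f → Q f M ∧
      ∀ M', Q f M' → ∑ e ∈ M, c e ≤ ∑ e ∈ M', c e) := by
    intro f
    by_cases hf : f ∈ cut s t U ∧ 0 < x f
    · obtain ⟨M, hM, hM'⟩ := Set.exists_min_image {M : Finset β | Q f M} (fun M => ∑ e ∈ M, c e)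
        (Set.toFinite _) (hQ f hf.1 hf.2)
      exact ⟨M, fun _ _ => ⟨hM, hM'⟩⟩
    · exact ⟨∅, fun h1 h2 => absurd ⟨h1, h2⟩ hf⟩
  choose N hN using hmin
  let α : β → ℝ := fun f => ∑ e ∈ N f, c e
  -- The fractional matching pays at least `α` for its part on the side `U`.
  have hα : ∑ f ∈ cut s t U, x f * α f ≤ ∑ e, outsideWeight s t (A \ U) x e * c e := by
    obtain ⟨M, h1, h2, h3, h4⟩ := out1 fun e => c e - if e ∈ cut s t U then α e else 0
    obtain ⟨f, hf⟩ := card_eq_one.1 h3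
    have hfm : f ∈ cut s t U ∩ M := by rw [hf]; exact mem_singleton_self f
    have h5 := (hN f (mem_inter.1 hfm).1 (h1 f (mem_inter.1 hfm).2).1).2 M ⟨h1, h2, hf⟩
    have h6 : ∑ e ∈ M, (if e ∈ cut s t U then α e else 0) = α f := by
      rw [← sum_filter, filter_mem_eq_inter, inter_comm, hf, sum_singleton]
    rw [sum_sub_distrib, h6] at h4
    simp only [mul_sub, sum_sub_distrib] at h4
    have h7 : ∑ e, outsideWeight s t (A \ U) x e * (if e ∈ cut s t U then α e else 0) =
        ∑ f ∈ cut s t U, x f * α f := by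
      simp only [mul_ite, mul_zero]
      rw [← sum_filter, filter_mem_eq_inter, univ_inter]
      refine sum_congr rfl fun e he => ?_
      rw [outsideWeight_of_mem_cut (hcut ▸ he)]
    rw [h7] at h4
    have : α f ≤ ∑ e ∈ M, c e := h5
    linarith
  obtain ⟨M, h1, h2, h3, h4⟩ := out2 fun e => if e ∈ cut s t U then α e else c e
  obtain ⟨f, hf⟩ := card_eq_one.1 h3
  have hfm : f ∈ cut s t U ∩ M := by rw [hf]; exact mem_singleton_self f
  obtain ⟨⟨g1, g2, g3⟩, -⟩ := hN f (mem_inter.1 hfm).1 (h1 f (mem_inter.1 hfm).2).1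
  have hfN : f ∈ N f := by
    have : f ∈ cut s t U ∩ N f := by rw [g3]; exact mem_singleton_self f
    exact (mem_inter.1 this).2
  have hMf : ∀ e ∈ M, e ∈ cut s t U → e = f := fun e he hec => by
    have : e ∈ cut s t U ∩ M := mem_inter.2 ⟨hec, he⟩
    rwa [hf, mem_singleton] at this
  have hNf : ∀ e ∈ N f, e ∈ cut s t U → e = f := fun e he hec => by
    have : e ∈ cut s t U ∩ N f := mem_inter.2 ⟨hec, he⟩
    rwa [g3, mem_singleton] at this
  refine ⟨N f ∪ M.erase f, ?_, ?_, ?_⟩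
  · intro e he
    rcases mem_union.1 he with he | he
    · exact (g1 e he).1
    · exact (h1 e (mem_of_mem_erase he)).1
  · intro v hv
    by_cases hvU : v ∈ U
    · rw [← g2 v hvU]
      congr 1
      ext e
      rw [mem_inter, mem_inter, mem_union, mem_erase]
      have : e ∈ cut s t {v} → e ∈ M → e = f := fun hev heM => by
        apply hMf e heM
        have h5 := (h1 e heM).2
        rw [mem_cut] at hev ⊢
        rw [mem_singleton, mem_singleton] at hev
        intro h6
        apply hev
        constructor
        · rintro rfl; exact absurd ⟨hvU, h6.1 hvU⟩ h5
        · rintro rfl; exact absurd ⟨h6.2 hvU, hvU⟩ h5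
      tauto
    · rw [← h2 v (mem_sdiff.2 ⟨hv, hvU⟩)]
      congr 1
      ext e
      rw [mem_inter, mem_inter, mem_union, mem_erase]
      have : e ∈ cut s t {v} → e ∈ N f → e = f := fun hev heM => by
        apply hNf e heM
        have h5 := (g1 e heM).2
        rw [mem_sdiff, mem_sdiff] at h5
        rw [mem_cut] at hev ⊢
        rw [mem_singleton, mem_singleton] at hev
        intro h6
        apply hev
        have hs := h.s_mem e
        have ht := h.t_mem e
        constructor
        · intro h7; rw [h7] at hs h5 h6; tauto
        · intro h7; rw [h7] at ht h5 h6; tauto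
      have hfM := (mem_inter.1 hfm).2
      constructor
      · rintro ⟨h5, h6 | h6⟩
        · obtain rfl := this h5 h6
          exact ⟨h5, hfM⟩
        · exact ⟨h5, h6.2⟩
      · rintro ⟨h5, h6⟩
        refine ⟨h5, ?_⟩
        by_cases hef : e = f
        · left; rw [hef]; exact hfN
        · exact Or.inr ⟨hef, h6⟩
  · have hdisj : Disjoint (N f) (M.erase f) := by
      rw [disjoint_left]
      intro e he he'
      obtain ⟨h5, h6⟩ := mem_erase.1 he'
      refine h5 (hMf e h6 (mem_cut.2 fun h7 => ?_))
      have h8 := (g1 e he).2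
      have h9 := (h1 e h6).2
      rw [mem_sdiff, mem_sdiff] at h8
      have hs := h.s_mem e
      have ht := h.t_mem e
      tauto
    rw [sum_union hdisj]
    have h5 : ∑ e ∈ M, (if e ∈ cut s t U then α e else c e) = α f + ∑ e ∈ M.erase f, c e := by
      rw [← add_sum_erase M _ (mem_inter.1 hfm).2, if_pos (mem_inter.1 hfm).1]
      congr 1
      refine sum_congr rfl fun e he => if_neg fun h6 => ?_
      exact (mem_erase.1 he).1 (hMf e (mem_erase.1 he).2 h6)
    rw [h5] at h4
    refine h4.trans ?_
    -- Split the edges into cut edges, edges inside `U` and edges inside `A \ U`.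
    have h6 : ∀ e, x e * c e = outsideWeight s t (A \ U) x e * c e +
        outsideWeight s t U x e * (if e ∈ cut s t U then α e else c e) -
        (if e ∈ cut s t U then x e * α e else 0) := by
      intro e
      have hs := h.s_mem e
      have ht := h.t_mem e
      unfold outsideWeight
      by_cases h7 : s e ∈ U <;> by_cases h8 : t e ∈ U <;> simp [mem_cut, h7, h8, hs, ht]
    rw [sum_congr rfl fun e _ => h6 e, sum_sub_distrib, sum_add_distrib, ← sum_filter,
      filter_mem_eq_inter, univ_inter]
    linarith

end

/-! ### Edmonds' perfect matching polytope -/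

theorem sum_indicator_eq_card_inter {β : Type*} [DecidableEq β] (D M : Finset β) :
    ∑ e ∈ D, (if e ∈ M then (1 : ℝ) else 0) = ((D ∩ M).card : ℝ) := by
  rw [← sum_filter, filter_mem_eq_inter, sum_const, nsmul_eq_mul, mul_one]

/-- The point `y` with `x = r χ_M + (1 - r) y`, where `χ_M` is the indicator function of `M`. -/
noncomputable def remainder [DecidableEq β] (x : β → ℝ) (M : Finset β) (r : ℝ) (e : β) : ℝ :=
  (x e - r * if e ∈ M then 1 else 0) / (1 - r)

theorem sum_remainder {β : Type*} [DecidableEq β] {x : β → ℝ} (M D : Finset β) (r : ℝ) :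
    ∑ e ∈ D, remainder x M r e = (∑ e ∈ D, x e - r * (D ∩ M).card) / (1 - r) := by
  unfold remainder
  rw [← sum_div, sum_sub_distrib, ← mul_sum, sum_indicator_eq_card_inter]

/-- Peeling off `M` stays in the polytope as long as the weights and the slacks of the cuts
permit. -/
theorem IsFracMatching.peel [DecidableEq β] (h : IsFracMatching A s t x) {M : Finset β} {r : ℝ}
    (hM : IsMatchingOn A s t M) (hM0 : ∀ e ∈ M, 0 < x e) (hr0 : 0 ≤ r) (hr1 : r < 1)
    (hrM : ∀ e ∈ M, r ≤ x e)
    (hrU : ∀ U ⊆ A, Odd U.card → 2 ≤ (cut s t U ∩ M).card →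
      r * ((cut s t U ∩ M).card - 1) ≤ ∑ e ∈ cut s t U, x e - 1) :
    IsFracMatching A s t (remainder x M r) := by
  have hr : 0 < 1 - r := by linarith
  refine ⟨h.s_mem, h.t_mem, fun e => ?_, fun e he => ?_, fun v hv => ?_, fun U hU hodd => ?_⟩
  · refine div_nonneg ?_ hr.le
    split_ifs with he
    · linarith [hrM e he]
    · linarith [h.nonneg e]
  · have h1 := h.loop e he
    have h2 : e ∉ M := fun h3 => (hM0 e h3).ne' h1
    simp [remainder, h1, h2]
  · rw [sum_remainder, h.star v hv, hM v hv, Nat.cast_one, mul_one, div_self hr.ne']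
  · rw [sum_remainder, le_div_iff₀ hr]
    rcases Nat.lt_or_ge (cut s t U ∩ M).card 2 with h2 | h2
    · have h3 : ((cut s t U ∩ M).card : ℝ) ≤ 1 := by exact_mod_cast Nat.le_of_lt_succ h2
      have := h.odd U hU hodd
      nlinarith
    · linarith [hrU U hU hodd h2]

theorem IsFracMatching.le_one (h : IsFracMatching A s t x) {e : β} (he : 0 < x e) : x e ≤ 1 := by
  have h1 : s e ≠ t e := fun h' => he.ne' (h.loop e h')
  rw [← h.star (s e) (h.s_mem e)]
  exact single_le_sum (f := x) (fun e _ => h.nonneg e) (mem_cut.2 (by simp [h1.symm]))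

/-- A fractional perfect matching that dominates the perfect matching `M` equals `M`. -/
theorem IsFracMatching.sum_mul_eq [DecidableEq β] (h : IsFracMatching A s t x) {M : Finset β}
    (hM : IsMatchingOn A s t M) (h1 : ∀ e ∈ M, 1 ≤ x e) (c : β → ℝ) :
    ∑ e, x e * c e = ∑ e ∈ M, c e := by
  have hx1 : ∀ e ∈ M, x e = 1 := fun e he =>
    le_antisymm (h.le_one (by linarith [h1 e he])) (h1 e he)
  have hx0 : ∀ e, e ∉ M → x e = 0 := by
    intro e he
    by_contra hne
    have hpos := lt_of_le_of_ne (h.nonneg e) (Ne.symm hne)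
    have hst : s e ≠ t e := fun h' => hpos.ne' (h.loop e h')
    have hv := h.s_mem e
    obtain ⟨f, hf⟩ := card_eq_one.1 (hM _ hv)
    have hf' : f ∈ cut s t {s e} ∩ M := by rw [hf]; exact mem_singleton_self f
    rw [mem_inter] at hf'
    have h2 : ∑ g ∈ {e, f}, x g ≤ ∑ g ∈ cut s t {s e}, x g := by
      refine sum_le_sum_of_subset_of_nonneg ?_ fun g _ _ => h.nonneg g
      intro g hg
      rcases mem_insert.1 hg with rfl | hg
      · exact mem_cut.2 (by simp [hst.symm])
      · rw [mem_singleton.1 hg]; exact hf'.1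
    rw [sum_pair (ne_of_mem_of_not_mem hf'.2 he).symm, h.star _ hv, hx1 f hf'.2] at h2
    linarith
  rw [← sum_subset (subset_univ M) fun e _ he => by rw [hx0 e he, zero_mul]]
  exact sum_congr rfl fun e he => by rw [hx1 e he, one_mul]

/-- Edmonds' description of the perfect matching polytope, in the form that every fractional
perfect matching supports a perfect matching of at most the same cost. If no odd cut is tight,
then a perfect matching of the support that costs too much can be peeled off until a weight vanishes
or an odd cut becomes tight, and what remains is cheaper than `x`. -/
theorem IsFracMatching.hasCheapMatching [DecidableEq β] (h : IsFracMatching A s t x) :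
    HasCheapMatching A s t x := by
  induction hn : A.card using Nat.strong_induction_on generalizing A s t x with
  | _ n ih =>
  subst hn
  have ihA : ∀ (A' : Finset V) (s' t' : β → V) (x' : β → ℝ), A'.card < A.card →
      IsFracMatching A' s' t' x' → HasCheapMatching A' s' t' x' :=
    fun A' s' t' x' hlt h' => ih _ hlt h' rfl
  clear ih
  induction hm : (univ.filter fun e => 0 < x e).card using Nat.strong_induction_on
    generalizing x with
  | _ m ihx =>
  subst hm
  by_cases htight : ∃ U ⊆ A, Odd U.card ∧ 2 ≤ U.card ∧ 2 ≤ (A \ U).card ∧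
      ∑ e ∈ cut s t U, x e = 1
  · obtain ⟨U, hU, hodd, h1, h2, h3⟩ := htight
    exact h.hasCheapMatching_of_tight hU hodd h1 h2 h3 ihA
  intro c
  obtain ⟨M, hM0, hM⟩ := h.exists_isMatchingOn
  by_cases hcM : ∑ e ∈ M, c e ≤ ∑ e, x e * c e
  · exact ⟨M, hM0, hM, hcM⟩
  rw [not_le] at hcM
  -- The values of `r` at which a weight vanishes or the cut of `U` becomes tight.
  let odds := A.powerset.filter fun U => Odd U.card ∧ 2 ≤ (cut s t U ∩ M).card
  let bound : Finset V → ℝ := fun U =>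
    (∑ e ∈ cut s t U, x e - 1) / ((cut s t U ∩ M).card - 1)
  have hodds : ∀ U, U ∈ odds ↔ U ⊆ A ∧ Odd U.card ∧ 2 ≤ (cut s t U ∩ M).card := by
    simp [odds]
  have hcards : ∀ U ∈ odds, 2 ≤ U.card ∧ 2 ≤ (A \ U).card := by
    intro U hU
    obtain ⟨h1, h2, h3⟩ := (hodds U).1 hU
    refine ⟨two_le_card_of_two_le_card_cut hM h1 h3,
      two_le_card_of_two_le_card_cut hM sdiff_subset ?_⟩
    rwa [cut_sdiff h.s_mem h.t_mem]
  have hden : ∀ U ∈ odds, (0 : ℝ) < (cut s t U ∩ M).card - 1 := by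
    intro U hU
    have : (2 : ℝ) ≤ (cut s t U ∩ M).card := by exact_mod_cast ((hodds U).1 hU).2.2
    linarith
  let S : Finset ℝ := M.image x ∪ odds.image bound
  have hMne : M.Nonempty := by
    rw [nonempty_iff_ne_empty]
    rintro rfl
    have : IsEmpty β := ⟨fun e => by simpa using hM _ (h.s_mem e)⟩
    simp at hcM
  have hSne : S.Nonempty := (hMne.image x).mono subset_union_left
  have hr := S.min'_mem hSne
  have hrle : ∀ y ∈ S, S.min' hSne ≤ y := fun y hy => S.min'_le y hy
  generalize S.min' hSne = r at hr hrle
  have hr0 : 0 < r := by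
    rcases mem_union.1 hr with hr | hr
    · obtain ⟨e, he, rfl⟩ := mem_image.1 hr
      exact hM0 e he
    · obtain ⟨U, hU, rfl⟩ := mem_image.1 hr
      refine div_pos ?_ (hden U hU)
      obtain ⟨h1, h2, h3⟩ := (hodds U).1 hU
      refine sub_pos.2 (lt_of_le_of_ne (h.odd U h1 h2) fun h4 => htight ?_)
      exact ⟨U, h1, h2, (hcards U hU).1, (hcards U hU).2, h4.symm⟩
  have hrM : ∀ e ∈ M, r ≤ x e := fun e he =>
    hrle _ (mem_union_left _ (mem_image_of_mem x he))
  have hrU : ∀ U ⊆ A, Odd U.card → 2 ≤ (cut s t U ∩ M).card →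
      r * ((cut s t U ∩ M).card - 1) ≤ ∑ e ∈ cut s t U, x e - 1 := by
    intro U h1 h2 h3
    have hU := (hodds U).2 ⟨h1, h2, h3⟩
    exact (le_div_iff₀ (hden U hU)).1 (hrle _ (mem_union_right _ (mem_image_of_mem bound hU)))
  rcases lt_or_ge r 1 with hr1 | hr1
  swap
  · exact absurd (h.sum_mul_eq hM (fun e he => hr1.trans (hrM e he)) c) hcM.ne
  have hr1' : 0 < 1 - r := by linarith
  have hy := h.peel hM hM0 hr0.le hr1 hrM hrU
  have hysupp : ∀ e, 0 < remainder x M r e → 0 < x e := by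
    intro e he
    by_cases heM : e ∈ M
    · exact hM0 e heM
    · simpa [remainder, heM, hr1'] using he
  have hyc : ∑ e, remainder x M r e * c e ≤ ∑ e, x e * c e := by
    have h1 : ∑ e, remainder x M r e * c e = (∑ e, x e * c e - r * ∑ e ∈ M, c e) / (1 - r) := by
      have h2 : ∑ e ∈ M, c e = ∑ e, if e ∈ M then c e else 0 := by
        rw [← sum_filter, filter_mem_eq_inter, univ_inter]
      rw [h2, mul_sum, ← sum_sub_distrib, sum_div]
      refine sum_congr rfl fun e _ => ?_
      unfold remainder
      split_ifs <;> ring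
    rw [h1, div_le_iff₀ hr1']
    nlinarith
  have hcheap : HasCheapMatching A s t (remainder x M r) := by
    rcases mem_union.1 hr with hr | hr
    · obtain ⟨e, he, hre⟩ := mem_image.1 hr
      refine ihx _ (card_lt_card ?_) hy rfl
      rw [ssubset_iff_of_subset fun f hf => by
        rw [mem_filter] at hf ⊢
        exact ⟨hf.1, hysupp f hf.2⟩]
      refine ⟨e, by simp [hM0 e he], ?_⟩
      simp [remainder, he, hre]
    · obtain ⟨U, hU, hrU⟩ := mem_image.1 hr
      obtain ⟨h1, h2, h3⟩ := (hodds U).1 hU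
      refine hy.hasCheapMatching_of_tight h1 h2 (hcards U hU).1 (hcards U hU).2 ?_ ihA
      rw [sum_remainder, div_eq_one_iff_eq hr1'.ne']
      have := (div_eq_iff (hden U hU).ne').1 hrU
      linarith
  obtain ⟨N, hN0, hN, hNc⟩ := hcheap c
  exact ⟨N, fun e he => hysupp e (hN0 e he), hN, hNc.trans hyc⟩

end CubicCover

/-! ### Depth-first search and removable edges -/

namespace CubicCover

open Finset


section
variable {V β : Type*} {s t : β → V}

/-- Two vertices of `S` are joined by an edge outside `F`. -/
def Step (s t : β → V) (F : Finset β) (S : Finset V) (a b : V) : Prop :=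
  a ∈ S ∧ b ∈ S ∧ ∃ e, e ∉ F ∧ s(s e, t e) = s(a, b)

/-- The subgraph induced by `S` is connected after the deletion of the edges in `F`; the empty set
counts as connected. -/
def ConnectedOn (s t : β → V) (F : Finset β) (S : Finset V) : Prop :=
  ∀ a ∈ S, ∀ b ∈ S, Relation.ReflTransGen (Step s t F S) a b

theorem Step.symm {F : Finset β} {S : Finset V} {a b : V} (h : Step s t F S a b) :
    Step s t F S b a := by
  obtain ⟨h1, h2, e, he, h3⟩ := h
  exact ⟨h2, h1, e, he, h3.trans Sym2.eq_swap⟩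

theorem reflTransGen_step_symm {F : Finset β} {S : Finset V} {a b : V}
    (h : Relation.ReflTransGen (Step s t F S) a b) : Relation.ReflTransGen (Step s t F S) b a := by
  induction h with
  | refl => exact .refl
  | tail _ h ih => exact .head h.symm ih

theorem ConnectedOn.of_forall {F : Finset β} {S : Finset V} (w : V)
    (h : ∀ a ∈ S, Relation.ReflTransGen (Step s t F S) a w) : ConnectedOn s t F S :=
  fun a ha b hb => (h a ha).trans (reflTransGen_step_symm (h b hb))

theorem reflTransGen_step_mono {F : Finset β} {S T : Finset V} (hST : S ⊆ T) {a b : V}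
    (h : Relation.ReflTransGen (Step s t F S) a b) : Relation.ReflTransGen (Step s t F T) a b := by
  induction h with
  | refl => exact .refl
  | tail _ h ih => exact .tail ih ⟨hST h.1, hST h.2.1, h.2.2⟩

open Classical in
/-- The component of `w` in the subgraph induced by `D`. -/
noncomputable def comp (s t : β → V) (D : Finset V) (w : V) : Finset V :=
  D.filter fun a => Relation.ReflTransGen (Step s t ∅ D) a w

theorem mem_comp {D : Finset V} {w a : V} :
    a ∈ comp s t D w ↔ a ∈ D ∧ Relation.ReflTransGen (Step s t ∅ D) a w := by
  simp [comp]

theorem self_mem_comp {D : Finset V} {w : V} (hw : w ∈ D) : w ∈ comp s t D w :=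
  mem_comp.2 ⟨hw, .refl⟩

theorem comp_subset (D : Finset V) (w : V) : comp s t D w ⊆ D := fun _ ha => (mem_comp.1 ha).1

theorem connectedOn_comp (D : Finset V) (w : V) : ConnectedOn s t ∅ (comp s t D w) := by
  refine .of_forall w fun a ha => ?_
  obtain ⟨-, h⟩ := mem_comp.1 ha
  clear ha
  induction h using Relation.ReflTransGen.head_induction_on with
  | refl => exact .refl
  | head hab hb ih =>
    exact .head ⟨mem_comp.2 ⟨hab.1, .head hab hb⟩, mem_comp.2 ⟨hab.2.1, hb⟩, hab.2.2⟩ ih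

/-- No edge of the subgraph induced by `D` leaves a component. -/
theorem mem_comp_of_edge {D : Finset V} {w a b : V} (ha : a ∈ comp s t D w) (hb : b ∈ D) {e : β}
    (he : s(s e, t e) = s(a, b)) : b ∈ comp s t D w := by
  obtain ⟨haD, har⟩ := mem_comp.1 ha
  exact mem_comp.2 ⟨hb, .head ⟨hb, haD, e, notMem_empty e, he.trans Sym2.eq_swap⟩ har⟩

theorem disjoint_comp {D : Finset V} {w w' : V}
    (h : ¬ Relation.ReflTransGen (Step s t ∅ D) w' w) :
    Disjoint (comp s t D w) (comp s t D w') := by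
  rw [disjoint_left]
  intro a ha ha'
  exact h ((reflTransGen_step_symm (mem_comp.1 ha').2).trans (mem_comp.1 ha).2)

end

section
variable {V β : Type*} [DecidableEq V] {s t : β → V}

theorem ConnectedOn.union {F : Finset β} {S T : Finset V} (hS : ConnectedOn s t F S)
    (hT : ConnectedOn s t F T) {w : V} (hwS : w ∈ S) (hwT : w ∈ T) :
    ConnectedOn s t F (S ∪ T) := by
  refine .of_forall w fun a ha => ?_
  rcases mem_union.1 ha with ha | ha
  · exact reflTransGen_step_mono subset_union_left (hS a ha w hwS)
  · exact reflTransGen_step_mono subset_union_right (hT a ha w hwT)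

theorem ConnectedOn.insert {F : Finset β} {S : Finset V} (hS : ConnectedOn s t F S) {v w : V}
    (hw : w ∈ S) {e : β} (he : e ∉ F) (hevw : s(s e, t e) = s(v, w)) :
    ConnectedOn s t F (insert v S) := by
  refine .of_forall w fun a ha => ?_
  rcases mem_insert.1 ha with rfl | ha
  · exact .single ⟨mem_insert_self _ _, mem_insert_of_mem hw, e, he, hevw⟩
  · exact reflTransGen_step_mono (subset_insert _ _) (hS a ha w hw)

/-- After `v` has been deleted, every vertex can still reach some neighbour of `v`. -/
theorem ConnectedOn.exists_reach_neighbor {S : Finset V} (hS : ConnectedOn s t ∅ S) {v : V}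
    (hv : v ∈ S) {a : V} (ha : a ∈ S.erase v) :
    ∃ w ∈ S.erase v, (∃ e, s(s e, t e) = s(v, w)) ∧
      Relation.ReflTransGen (Step s t ∅ (S.erase v)) a w := by
  have h := hS a (mem_of_mem_erase ha) v hv
  have hne := (mem_erase.1 ha).1
  clear ha
  induction h using Relation.ReflTransGen.head_induction_on with
  | refl => exact absurd rfl hne
  | @head a b hab _ ih =>
    obtain ⟨haS, hbS, e, he, hee⟩ := hab
    by_cases hb : b = v
    · subst hb
      exact ⟨a, mem_erase.2 ⟨hne, haS⟩, ⟨e, hee.trans Sym2.eq_swap⟩, .refl⟩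
    · obtain ⟨w, hw, hvw, hreach⟩ := ih hb
      exact ⟨w, hw, hvw, .head ⟨mem_erase.2 ⟨hne, haS⟩, mem_erase.2 ⟨hb, hbS⟩, e, he, hee⟩ hreach⟩

variable [Fintype β]

theorem mem_cut_iff_exists {U : Finset V} {e : β} :
    e ∈ cut s t U ↔ ∃ a ∈ U, ∃ b ∉ U, s(s e, t e) = s(a, b) := by
  rw [mem_cut]
  constructor
  · intro h
    by_cases h1 : s e ∈ U
    · exact ⟨s e, h1, t e, by tauto, rfl⟩
    · exact ⟨t e, by tauto, s e, h1, Sym2.eq_swap⟩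
  · rintro ⟨a, ha, b, hb, h⟩
    rcases Sym2.eq_iff.1 h with ⟨h1, h2⟩ | ⟨h1, h2⟩
    · rw [h1, h2]; tauto
    · rw [h1, h2]; tauto

theorem mem_cut_of_eq {U : Finset V} {e : β} {a b : V} (h : s(s e, t e) = s(a, b)) (ha : a ∈ U)
    (hb : b ∉ U) : e ∈ cut s t U :=
  mem_cut_iff_exists.2 ⟨a, ha, b, hb, h⟩

theorem card_cut_union [DecidableEq β] {C D : Finset V} (h : Disjoint C D) :
    (cut s t (C ∪ D)).card + 2 * (cut s t C ∩ cut s t D).card =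
      (cut s t C).card + (cut s t D).card := by
  have h1 : cut s t (C ∪ D) = (cut s t C ∪ cut s t D) \ (cut s t C ∩ cut s t D) := by
    ext e
    have h1 := fun h' : s e ∈ C => disjoint_left.1 h h'
    have h2 := fun h' : t e ∈ C => disjoint_left.1 h h'
    simp only [mem_cut, mem_union, mem_sdiff, mem_inter]
    tauto
  have h2 : cut s t C ∩ cut s t D ⊆ cut s t C ∪ cut s t D :=
    inter_subset_left.trans subset_union_left
  have h3 := card_sdiff_add_card_eq_card h2
  have h4 := card_union_add_card_inter (cut s t C) (cut s t D)
  rw [← h1] at h3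
  omega

theorem cut_inter_cut_comp [DecidableEq β] {D : Finset V} {w w' : V}
    (h : Disjoint (comp s t D w) (comp s t D w')) :
    cut s t (comp s t D w) ∩ cut s t (comp s t D w') = ∅ := by
  rw [eq_empty_iff_forall_notMem]
  intro e he
  obtain ⟨h1, h2⟩ := mem_inter.1 he
  obtain ⟨a, ha, b, hb, hab⟩ := mem_cut_iff_exists.1 h1
  obtain ⟨a', ha', b', hb', hab'⟩ := mem_cut_iff_exists.1 h2
  have hne : a ≠ a' := fun h' => disjoint_left.1 h ha (h' ▸ ha')
  rcases Sym2.eq_iff.1 (hab.symm.trans hab') with ⟨h3, -⟩ | ⟨-, h3⟩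
  · exact hne h3
  · exact hb (mem_comp_of_edge ha (h3 ▸ comp_subset _ _ ha') hab)

theorem odd_card_cut_iff [DecidableEq β] (hcub : ∀ v, (cut s t {v}).card = 3) (U : Finset V) :
    Odd (cut s t U).card ↔ Odd U.card := by
  induction U using Finset.induction_on with
  | empty => simp [cut]
  | insert v U hv ih =>
    have h := card_cut_union (s := s) (t := t) (disjoint_singleton_left.2 hv)
    rw [← insert_eq, hcub v] at h
    rw [card_insert_of_notMem hv]
    rw [Nat.odd_iff, Nat.odd_iff] at ih ⊢
    omega

theorem mem_cut_singleton {v w : V} {e : β} (hne : v ≠ w) (he : s(s e, t e) = s(v, w)) :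
    e ∈ cut s t {v} :=
  mem_cut_of_eq he (mem_singleton_self v) (by simpa using hne.symm)

/-- A vertex-disjoint set of edges misses one of any two edges at a common vertex. -/
theorem exists_notMem_of_two_le [DecidableEq β] {F X : Finset β} {v : V}
    (hF : (cut s t {v} ∩ F).card ≤ 1) (hX : X ⊆ cut s t {v}) (h2 : 2 ≤ X.card) :
    ∃ e ∈ X, e ∉ F := by
  by_contra hcon
  push Not at hcon
  have := card_le_card (show X ⊆ cut s t {v} ∩ F from fun e he => mem_inter.2 ⟨hX he, hcon e he⟩)
  omega

/-- The inductive step of the depth-first search. Let `v` be the first vertex of the connected set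
`S` to be visited, reached through an edge from outside. Then some set `N` of at most
`(|S| + |δ(S)|) / 2 - 2` edges has the property that deleting a set of vertex-disjoint edges
outside `N` leaves `S` connected. The search continues with the components of `S - v`, of
which there are at most two; the edge from `v` to a component is put into `N` only if there is
no second one. -/
theorem exists_essential_edges [DecidableEq β] (hcub : ∀ v, (cut s t {v}).card = 3)
    (S : Finset V) (v : V) (hv : v ∈ S) (hS : ConnectedOn s t ∅ S)
    (hout : ∃ f ∈ cut s t {v}, f ∈ cut s t S) :
    ∃ N : Finset β, 2 * N.card + 4 ≤ S.card + (cut s t S).card ∧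
      ∀ F : Finset β, (∀ u, (cut s t {u} ∩ F).card ≤ 1) → Disjoint F N → ConnectedOn s t F S := by
  induction hn : S.card using Nat.strong_induction_on generalizing S v with
  | _ n ih =>
  subst hn
  have hdisj : Disjoint {v} (S.erase v) := by simp
  have hSv : {v} ∪ S.erase v = S := by
    rw [← insert_eq, insert_erase hv]
  have hScard := card_erase_add_one hv
  have hcut := card_cut_union (s := s) (t := t) hdisj
  rw [hSv, hcub v] at hcut
  obtain ⟨f, hfv, hfS⟩ := hout
  have hX2 : (cut s t {v} ∩ cut s t (S.erase v)).card ≤ 2 := by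
    have hf : f ∉ cut s t (S.erase v) := by
      rw [mem_cut] at hfv hfS ⊢
      simp only [mem_singleton, mem_erase] at hfv hfS ⊢
      by_cases h1 : s f = v
      · have h2 : t f ≠ v := by tauto
        rw [h1] at hfS ⊢
        tauto
      · have h2 : t f = v := by tauto
        rw [h2] at hfS ⊢
        tauto
    have h1 : cut s t {v} ∩ cut s t (S.erase v) ⊆ (cut s t {v}).erase f := by
      intro e he
      rw [mem_inter] at he
      exact mem_erase.2 ⟨fun h => hf (h ▸ he.2), he.1⟩
    have := card_le_card h1
    rw [card_erase_of_mem hfv, hcub v] at this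
    exact this
  have hmemX : ∀ e, e ∈ cut s t {v} ∩ cut s t (S.erase v) ↔
      ∃ w ∈ S.erase v, s(s e, t e) = s(v, w) := by
    intro e
    rw [mem_inter]
    constructor
    · rintro ⟨h1, h2⟩
      obtain ⟨a, ha, b, hb, hab⟩ := mem_cut_iff_exists.1 h1
      obtain ⟨a', ha', b', hb', hab'⟩ := mem_cut_iff_exists.1 h2
      obtain rfl := mem_singleton.1 ha
      refine ⟨a', ha', ?_⟩
      rcases Sym2.eq_iff.1 (hab.symm.trans hab') with ⟨h3, -⟩ | ⟨h3, -⟩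
      · rw [← h3] at ha'
        simp at ha'
      · rw [hab', h3]
        exact Sym2.eq_swap
    · rintro ⟨w, hw, he⟩
      exact ⟨mem_cut_singleton (mem_erase.1 hw).1.symm he,
        mem_cut_of_eq (he.trans Sym2.eq_swap) hw (notMem_erase v S)⟩
  by_cases hD : S.erase v = ∅
  · refine ⟨∅, ?_, fun F _ _ => ?_⟩
    · have : S = {v} := by rw [← hSv, hD, union_empty]
      simp [this, hcub v]
    · have : S = {v} := by rw [← hSv, hD, union_empty]
      rw [this]
      intro a ha b hb
      rw [mem_singleton.1 ha, mem_singleton.1 hb]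
  obtain ⟨a, ha⟩ := nonempty_iff_ne_empty.2 hD
  obtain ⟨w, hw, ⟨e, he⟩, -⟩ := hS.exists_reach_neighbor hv ha
  have heX := (hmemX e).2 ⟨w, hw, he⟩
  by_cases hconn : ConnectedOn s t ∅ (S.erase v)
  · obtain ⟨N, hN, hNF⟩ := ih _ (by omega) (S.erase v) w hw hconn
      ⟨e, mem_cut_singleton (mem_erase.1 hw).1 (he.trans Sym2.eq_swap), (mem_inter.1 heX).2⟩ rfl
    have hX1 : 1 ≤ (cut s t {v} ∩ cut s t (S.erase v)).card := card_pos.2 ⟨e, heX⟩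
    by_cases hX : 2 ≤ (cut s t {v} ∩ cut s t (S.erase v)).card
    · refine ⟨N, by omega, fun F hF hFN => ?_⟩
      obtain ⟨g, hgX, hgF⟩ := exists_notMem_of_two_le (hF v) inter_subset_left hX
      obtain ⟨u, hu, hg⟩ := (hmemX g).1 hgX
      have := (hNF F hF hFN).insert hu hgF hg
      rwa [insert_erase hv] at this
    · refine ⟨insert e N, ?_, fun F hF hFN => ?_⟩
      · have := card_insert_le e N
        omega
      · rw [disjoint_insert_right] at hFN
        have := (hNF F hF hFN.2).insert hw hFN.1 he
        rwa [insert_erase hv] at this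
  · -- Some vertex does not reach `w`; it reaches another neighbour `w'` of `v`.
    obtain ⟨b, hb, hbw⟩ : ∃ b ∈ S.erase v,
        ¬ Relation.ReflTransGen (Step s t ∅ (S.erase v)) b w := by
      by_contra hcon
      push Not at hcon
      exact hconn (.of_forall w hcon)
    obtain ⟨w', hw', ⟨e', he'⟩, hbw'⟩ := hS.exists_reach_neighbor hv hb
    have hww' : ¬ Relation.ReflTransGen (Step s t ∅ (S.erase v)) w' w :=
      fun h => hbw (hbw'.trans h)
    have heX' := (hmemX e').2 ⟨w', hw', he'⟩
    have hee' : e ≠ e' := by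
      rintro rfl
      obtain rfl := Sym2.congr_right.1 (he.symm.trans he')
      exact hww' .refl
    have hX : ({e, e'} : Finset β) = cut s t {v} ∩ cut s t (S.erase v) := by
      refine eq_of_subset_of_card_le (insert_subset heX (singleton_subset_iff.2 heX')) ?_
      rwa [card_pair hee']
    have hC := disjoint_comp (s := s) (t := t) hww'
    have hunion : comp s t (S.erase v) w ∪ comp s t (S.erase v) w' = S.erase v := by
      refine subset_antisymm (union_subset (comp_subset _ _) (comp_subset _ _)) fun c hc => ?_
      obtain ⟨u, hu, ⟨g, hg⟩, hcu⟩ := hS.exists_reach_neighbor hv hc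
      have hgX := (hmemX g).2 ⟨u, hu, hg⟩
      rw [← hX, mem_insert, mem_singleton] at hgX
      rw [mem_union, mem_comp, mem_comp]
      rcases hgX with rfl | rfl
      · rw [Sym2.congr_right.1 (he.symm.trans hg)]
        exact Or.inl ⟨hc, hcu⟩
      · rw [Sym2.congr_right.1 (he'.symm.trans hg)]
        exact Or.inr ⟨hc, hcu⟩
    have hcutC := card_cut_union (s := s) (t := t) hC
    have hcardC := card_union_of_disjoint hC
    rw [cut_inter_cut_comp hC, hunion] at hcutC
    rw [hunion] at hcardC
    rw [← hX, card_pair hee'] at hcut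
    have hwC := self_mem_comp (s := s) (t := t) hw
    have hwC' := self_mem_comp (s := s) (t := t) hw'
    have hvC : ∀ u, v ∉ comp s t (S.erase v) u := fun u h => notMem_erase v S (comp_subset _ _ h)
    obtain ⟨N, hN, hNF⟩ := ih _ (by have := card_pos.2 ⟨_, hwC'⟩; omega) _ w hwC
      (connectedOn_comp _ _)
      ⟨e, mem_cut_singleton (mem_erase.1 hw).1 (he.trans Sym2.eq_swap),
        mem_cut_of_eq (he.trans Sym2.eq_swap) hwC (hvC _)⟩ rfl
    obtain ⟨N', hN', hNF'⟩ := ih _ (by have := card_pos.2 ⟨_, hwC⟩; omega) _ w' hwC'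
      (connectedOn_comp _ _)
      ⟨e', mem_cut_singleton (mem_erase.1 hw').1 (he'.trans Sym2.eq_swap),
        mem_cut_of_eq (he'.trans Sym2.eq_swap) hwC' (hvC _)⟩ rfl
    refine ⟨insert e (insert e' (N ∪ N')), ?_, fun F hF hFN => ?_⟩
    · have h1 := card_insert_le e (insert e' (N ∪ N'))
      have h2 := card_insert_le e' (N ∪ N')
      have h3 := card_union_le N N'
      rw [card_empty] at hcutC
      omega
    · rw [disjoint_insert_right, disjoint_insert_right, disjoint_union_right] at hFN
      obtain ⟨h1, h2, h3, h4⟩ := hFN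
      have h5 := ((hNF F hF h3).insert hwC h1 he).union ((hNF' F hF h4).insert hwC' h2 he')
        (mem_insert_self _ _) (mem_insert_self _ _)
      rwa [← insert_union_distrib, hunion, insert_erase hv] at h5

/-- In a bridgeless cubic graph the search never branches at its root, since each component of the
rest would be joined to the root by at least two of its three edges. -/
theorem exists_essential_edges_univ [DecidableEq β] [Fintype V] [Nonempty V]
    (hcub : ∀ v, (cut s t {v}).card = 3)
    (hbr : ∀ U, (cut s t U).card ≠ 1) (hconn : ConnectedOn s t ∅ univ) :
    ∃ N : Finset β, 2 * N.card + 2 ≤ Fintype.card V ∧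
      ∀ F : Finset β, (∀ u, (cut s t {u} ∩ F).card ≤ 1) → Disjoint F N →
        ConnectedOn s t F univ := by
  obtain ⟨v⟩ := ‹Nonempty V›
  have hv : v ∈ (univ : Finset V) := mem_univ v
  have hcutD : cut s t (univ.erase v) = cut s t {v} := by
    rw [← sdiff_singleton_eq_erase]
    exact cut_sdiff (fun e => mem_univ _) (fun e => mem_univ _) _
  have hmem : ∀ e ∈ cut s t {v}, ∃ w ∈ univ.erase v, s(s e, t e) = s(v, w) := by
    intro e he
    obtain ⟨a, ha, b, hb, hab⟩ := mem_cut_iff_exists.1 he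
    obtain rfl := mem_singleton.1 ha
    exact ⟨b, by simpa using hb, hab⟩
  obtain ⟨e, he⟩ := card_pos.1 (show 0 < (cut s t {v}).card by rw [hcub v]; norm_num)
  obtain ⟨w, hw, hvw⟩ := hmem e he
  have hconnD : ConnectedOn s t ∅ (univ.erase v) := by
    by_contra hcon
    obtain ⟨b, hb, hbw⟩ : ∃ b ∈ univ.erase v,
        ¬ Relation.ReflTransGen (Step s t ∅ (univ.erase v)) b w := by
      by_contra hcon'
      push Not at hcon'
      exact hcon (.of_forall w hcon')
    obtain ⟨w', hw', ⟨e', he'⟩, hbw'⟩ := hconn.exists_reach_neighbor hv hb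
    have hC := disjoint_comp (s := s) (t := t) fun h => hbw (hbw'.trans h)
    have hcard : ∀ u ∈ univ.erase v, (∃ g, s(s g, t g) = s(v, u)) →
        2 ≤ (cut s t (comp s t (univ.erase v) u)).card ∧
          cut s t (comp s t (univ.erase v) u) ⊆ cut s t {v} := by
      rintro u hu ⟨g, hg⟩
      have h1 : g ∈ cut s t (comp s t (univ.erase v) u) :=
        mem_cut_of_eq (hg.trans Sym2.eq_swap) (self_mem_comp hu)
          fun h => notMem_erase v univ (comp_subset _ _ h)
      have h2 := card_pos.2 ⟨g, h1⟩
      have h3 := hbr (comp s t (univ.erase v) u)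
      refine ⟨by omega, fun f hf => ?_⟩
      obtain ⟨a, ha, c, hc, hac⟩ := mem_cut_iff_exists.1 hf
      have hcv : c = v := by
        by_contra hcv
        exact hc (mem_comp_of_edge ha (by simpa using hcv) hac)
      subst hcv
      refine mem_cut_of_eq (hac.trans Sym2.eq_swap) (mem_singleton_self _) ?_
      rw [mem_singleton]
      exact (mem_erase.1 (comp_subset _ _ ha)).1
    obtain ⟨h1, h2⟩ := hcard w hw ⟨e, hvw⟩
    obtain ⟨h3, h4⟩ := hcard w' hw' ⟨e', he'⟩
    have h5 := card_union_of_disjoint (disjoint_iff_inter_eq_empty.2 (cut_inter_cut_comp hC))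
    have h6 := card_le_card (union_subset h2 h4)
    rw [hcub v] at h6
    omega
  obtain ⟨N, hN, hNF⟩ := exists_essential_edges hcub (univ.erase v) w hw hconnD
    ⟨e, mem_cut_singleton (mem_erase.1 hw).1 (hvw.trans Sym2.eq_swap), hcutD ▸ he⟩
  rw [hcutD, hcub v] at hN
  have := card_erase_add_one hv
  rw [card_univ] at this
  refine ⟨N, by omega, fun F hF hFN => ?_⟩
  obtain ⟨g, hg, hgF⟩ := exists_notMem_of_two_le (hF v) subset_rfl (by rw [hcub v]; norm_num)
  obtain ⟨u, hu, hvu⟩ := hmem g hg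
  have := (hNF F hF hFN).insert hu hgF hvu
  rwa [insert_erase hv] at this
end
end CubicCover

/-! ### Spanning trees and cycles of multigraphs -/

namespace Graph

variable {α β : Type*} {G : Graph α β}

theorem Reachable.symm {x y : α} (h : G.Reachable x y) : G.Reachable y x := by
  unfold Graph.Reachable at *
  induction h with
  | refl => exact .refl
  | tail _ h ih => exact .head h.symm ih

/-- Deleting an edge of a cycle keeps the graph connected. -/
theorem IsConnected.restrict_sdiff_of_isCycle {T : Set β} (h : (G.restrict T).IsConnected)
    {k : ℕ} (hk : 1 ≤ k) {v : ZMod k → α} {e : ZMod k → β} (he : Function.Injective e)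
    (hlink : ∀ i, (G.restrict T).IsLink (e i) (v i) (v (i + 1))) :
    (G.restrict (T \ {e 0})).IsConnected := by
  refine ⟨h.1, fun x y hx hy => ?_⟩
  have hne : ∀ j : ℕ, 0 < j → j < k → (j : ZMod k) ≠ 0 := by
    intro j hj hjk h0
    rw [ZMod.natCast_eq_zero_iff] at h0
    exact absurd (Nat.le_of_dvd hj h0) (not_le.2 hjk)
  have hround : ∀ j : ℕ, j + 1 ≤ k → (G.restrict (T \ {e 0})).Reachable (v 1) (v (j + 1 : ℕ)) := by
    intro j
    induction j with
    | zero => intro _; rw [zero_add, Nat.cast_one]; exact .refl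
    | succ j ih =>
      intro hj
      refine .tail (ih (by omega)) ⟨e (j + 1 : ℕ), ?_⟩
      have h1 := hlink (j + 1 : ℕ)
      rw [restrict_isLink] at h1 ⊢
      refine ⟨⟨h1.1, fun h2 => hne (j + 1) (by omega) (by omega) (he h2)⟩, ?_⟩
      have h3 := h1.2
      rwa [← Nat.cast_succ] at h3
  have h10 : (G.restrict (T \ {e 0})).Reachable (v 1) (v 0) := by
    have := hround (k - 1) (by omega)
    rwa [Nat.sub_add_cancel hk, ZMod.natCast_self] at this
  have hstep : ∀ a b, (G.restrict T).Adj a b → (G.restrict (T \ {e 0})).Reachable a b := by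
    rintro a b ⟨f, hf⟩
    by_cases hfe : f = e 0
    · subst hfe
      have h0 := hlink 0
      rw [zero_add] at h0
      rcases hf.eq_and_eq_or_eq_and_eq h0 with ⟨rfl, rfl⟩ | ⟨rfl, rfl⟩
      exacts [h10.symm, h10]
    · rw [restrict_isLink] at hf
      refine .single ⟨f, ?_⟩
      rw [restrict_isLink]
      exact ⟨⟨hf.1, hfe⟩, hf.2⟩
  have hxy := h.2 x y hx hy
  unfold Graph.Reachable at hxy
  induction hxy with
  | refl => exact .refl
  | tail hab hbc ih => exact .trans (ih hbc.left_mem) (hstep _ _ hbc)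

/-- A minimal connected set of edges is a spanning tree. -/
theorem exists_isSpanningTree {F : Set β} (hF : F.Finite) (hFG : F ⊆ G.edgeSet)
    (h : (G.restrict F).IsConnected) : ∃ T ⊆ F, G.IsSpanningTree T := by
  obtain ⟨T, ⟨hTF, hT⟩, hmin⟩ := Set.exists_min_image
    {T : Set β | T ⊆ F ∧ (G.restrict T).IsConnected} Set.ncard
    (hF.finite_subsets.subset fun T hT => hT.1) ⟨F, subset_rfl, h⟩
  refine ⟨T, hTF, hTF.trans hFG, hT, ?_⟩
  rintro C hC ⟨k, hk, v, e, -, he, -, -, hlink⟩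
  have hlink' := fun i => (hlink i).mono hC
  have h1 := hmin (T \ {e 0})
    ⟨Set.sdiff_subset.trans hTF, hT.restrict_sdiff_of_isCycle hk he hlink'⟩
  have h0 : e 0 ∈ T := by
    have := hlink' 0
    rw [restrict_isLink] at this
    exact this.1
  have h2 := Set.ncard_sdiff_singleton_lt_of_mem h0 (hF.subset hTF)
  omega

/-- For fixed-point free involutions `r` and `s`, the orbit of `d` under `r * s` does not contain
`r d`. Otherwise `r` and `s` would act on this orbit as reflections, and one of them would have a
fixed point there. -/
theorem zpow_apply_ne_of_involutive {D : Type*} {r s : Equiv.Perm D} (hr : ∀ d, r (r d) = d)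
    (hs : ∀ d, s (s d) = d) (hr' : ∀ d, r d ≠ d) (hs' : ∀ d, s d ≠ d) (d : D) (j : ℤ) :
    ((r * s) ^ j) d ≠ r d := by
  intro h
  have hrr : r * r = 1 := Equiv.ext hr
  have hss : s * s = 1 := Equiv.ext hs
  have hri : r⁻¹ = r := inv_eq_of_mul_eq_one_left hrr
  have hsi : s⁻¹ = s := inv_eq_of_mul_eq_one_left hss
  have hconj : r * (r * s) * r⁻¹ = (r * s)⁻¹ := by
    rw [mul_inv_rev, hri, hsi, ← mul_assoc, hrr, one_mul]
  have hrefl : ∀ i : ℤ, r (((r * s) ^ i) d) = ((r * s) ^ (j - i)) d := by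
    intro i
    have h1 : r * (r * s) ^ i * r⁻¹ = (r * s) ^ (-i) := by
      rw [← conj_zpow, hconj, inv_zpow, zpow_neg]
    have h2 : r * (r * s) ^ i = (r * s) ^ (-i) * r := by
      rw [← h1, inv_mul_cancel_right]
    calc r (((r * s) ^ i) d) = (r * (r * s) ^ i) d := rfl
      _ = ((r * s) ^ (-i)) (r d) := by rw [h2]; rfl
      _ = ((r * s) ^ (-i)) (((r * s) ^ j) d) := by rw [h]
      _ = ((r * s) ^ (-i + j)) d := by rw [zpow_add]; rfl
      _ = _ := by rw [neg_add_eq_sub]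
  rcases Int.even_or_odd' j with ⟨i, rfl | rfl⟩
  · refine hr' (((r * s) ^ i) d) ?_
    rw [hrefl]
    congr 2
    ring
  · refine hs' (((r * s) ^ i) d) ?_
    have h1 : s (((r * s) ^ i) d) = r (((r * s) ^ (i + 1)) d) := by
      rw [add_comm, zpow_add, zpow_one]
      exact (hr _).symm
    rw [h1, hrefl]
    congr 2
    ring

/-- An edge of `G` together with one of its ends. -/
abbrev Dart (G : Graph α β) : Type _ := {p : α × β // G.Inc p.2 p.1}

theorem Dart.ext' {d d' : G.Dart} (h1 : d.1.1 = d'.1.1) (h2 : d.1.2 = d'.1.2) : d = d' :=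
  Subtype.ext (Prod.ext h1 h2)

/-- Two involutions of the darts of a 2-regular graph: `r` turns to the other edge at the same
vertex, and `s` passes to the other end of the same edge. -/
theorem exists_dart_involutions [G.Loopless]
    (h2 : ∀ v ∈ G.vertexSet, {e | G.Inc e v}.ncard = 2) :
    ∃ r s : Equiv.Perm G.Dart, (∀ d, r (r d) = d) ∧ (∀ d, s (s d) = d) ∧
      (∀ d, (r d).1.1 = d.1.1 ∧ (r d).1.2 ≠ d.1.2) ∧
      (∀ d, (s d).1.2 = d.1.2 ∧ G.IsLink d.1.2 d.1.1 (s d).1.1) ∧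
      (∀ d d', d'.1.1 = d.1.1 → d' ≠ d → d' = r d) ∧
      (∀ d d', d'.1.2 = d.1.2 → d' ≠ d → d' = s d) := by
  have hr : ∀ d : G.Dart, ∃ d' : G.Dart, (d'.1.1 = d.1.1 ∧ d'.1.2 ≠ d.1.2) ∧
      ∀ c : G.Dart, c.1.1 = d.1.1 → c ≠ d → c = d' := by
    rintro ⟨⟨v, e⟩, hd⟩
    obtain ⟨a, b, hab, hset⟩ := Set.ncard_eq_two.1 (h2 v hd.vertex_mem)
    have hmem : ∀ f, G.Inc f v ↔ f = a ∨ f = b := fun f => by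
      have : f ∈ {e | G.Inc e v} ↔ f ∈ ({a, b} : Set β) := by rw [hset]
      simpa using this
    have key : ∃ e', G.Inc e' v ∧ e' ≠ e ∧ ∀ f, G.Inc f v → f ≠ e → f = e' := by
      rcases (hmem e).1 hd with rfl | rfl
      · exact ⟨b, (hmem b).2 (Or.inr rfl), hab.symm, fun f hf hfe =>
          ((hmem f).1 hf).resolve_left hfe⟩
      · exact ⟨a, (hmem a).2 (Or.inl rfl), hab, fun f hf hfe =>
          ((hmem f).1 hf).resolve_right hfe⟩
    obtain ⟨e', he', hne, huniq⟩ := key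
    refine ⟨⟨⟨v, e'⟩, he'⟩, ⟨rfl, hne⟩, ?_⟩
    rintro ⟨⟨w, f⟩, hc⟩ hw hcd
    obtain rfl : w = v := hw
    exact Dart.ext' rfl (huniq f hc fun h => hcd (Dart.ext' rfl h))
  have hs : ∀ d : G.Dart, ∃ d' : G.Dart, (d'.1.2 = d.1.2 ∧ G.IsLink d.1.2 d.1.1 d'.1.1) ∧
      ∀ c : G.Dart, c.1.2 = d.1.2 → c ≠ d → c = d' := by
    rintro ⟨⟨v, e⟩, hd⟩
    obtain ⟨w, hw⟩ := id hd
    refine ⟨⟨⟨w, e⟩, hw.inc_right⟩, ⟨rfl, hw⟩, ?_⟩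
    rintro ⟨⟨u, f⟩, hc⟩ hf hcd
    obtain rfl : f = e := hf
    refine Dart.ext' ?_ rfl
    exact (Inc.eq_or_eq_of_isLink hc hw).resolve_left fun h => hcd (Dart.ext' h rfl)
  choose r hr1 hr2 using hr
  choose s hs1 hs2 using hs
  have hne : ∀ d, s d ≠ d := by
    intro d h
    have h1 := (hs1 d).2
    rw [h] at h1
    exact Loopless.not_isLoopAt _ _ h1
  have hrr : Function.Involutive r := fun d =>
    (hr2 (r d) d (hr1 d).1.symm fun h => (hr1 d).2 (by rw [← h])).symm
  have hss : Function.Involutive s := fun d =>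
    (hs2 (s d) d (hs1 d).1.symm (hne d).symm).symm
  exact ⟨hrr.toPerm r, hss.toPerm s, hrr, hss, hr1, hs1, hr2, hs2⟩

/-- A component of a finite 2-regular graph is a cycle: alternately turning to the other edge and
passing to its other end is a permutation of the darts, whose orbits trace the components. -/
theorem isCycle_induce_reachable [G.Loopless] (hV : G.vertexSet.Finite) (hE : G.edgeSet.Finite)
    (h2 : ∀ v ∈ G.vertexSet, {e | G.Inc e v}.ncard = 2) {x : α} (hx : x ∈ G.vertexSet) :
    (G.induce {w | G.Reachable x w}).IsCycle := by
  obtain ⟨r, s, hrr, hss, hr, hs, hr', hs'⟩ := exists_dart_involutions h2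
  have hfin : Finite G.Dart := by
    refine Set.Finite.to_subtype ((hV.prod hE).subset ?_)
    rintro ⟨v, e⟩ h
    exact ⟨Inc.vertex_mem h, Inc.edge_mem h⟩
  have hrne : ∀ d, r d ≠ d := fun d h => (hr d).2 (by rw [h])
  have hsne : ∀ d, s d ≠ d := by
    intro d h
    have h1 := (hs d).2
    rw [h] at h1
    exact Loopless.not_isLoopAt _ _ h1
  obtain ⟨e₀, he₀⟩ : {e | G.Inc e x}.Nonempty := by
    rw [← Set.ncard_pos (Set.finite_of_ncard_ne_zero (by rw [h2 x hx]; norm_num)), h2 x hx]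
    norm_num
  let d₀ : G.Dart := ⟨(x, e₀), he₀⟩
  set p := r * s with hp
  let k := Function.minimalPeriod (p • ·) d₀
  have hk : 0 < k := by
    refine Function.minimalPeriod_pos_of_mem_periodicPts ?_
    exact (MulAction.injective p).mem_periodicPts d₀
  have : NeZero k := ⟨hk.ne'⟩
  let g : ZMod k → G.Dart := fun i => (MulAction.orbitZPowersEquiv p d₀).symm i
  have hginj : Function.Injective g := fun i j hij =>
    (MulAction.orbitZPowersEquiv p d₀).symm.injective (Subtype.ext hij)
  have hgz : ∀ m : ℤ, g m = (p ^ m) d₀ := by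
    intro m
    simp only [g]
    rw [MulAction.orbitZPowersEquiv_symm_apply']
    rfl
  have hgz' : ∀ i : ZMod k, ∃ m : ℤ, i = m := fun i => ⟨i.val, by simp⟩
  have hgadd : ∀ i (m : ℤ), g (i + m) = (p ^ m) (g i) := by
    intro i m
    obtain ⟨n, rfl⟩ := hgz' i
    rw [← Int.cast_add, hgz, hgz, add_comm, zpow_add]
    rfl
  have hg1 : ∀ i, g (i + 1) = r (s (g i)) := by
    intro i
    have := hgadd i 1
    rwa [Int.cast_one, zpow_one] at this
  have hg0 : g 0 = d₀ := by
    have := hgz 0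
    rwa [Int.cast_zero, zpow_zero] at this
  have hgr : ∀ i j, g j ≠ r (g i) := by
    intro i j h
    obtain ⟨m, hm⟩ := hgz' (j - i)
    refine zpow_apply_ne_of_involutive hrr hss hrne hsne (g i) m ?_
    rw [← hp, ← hgadd, ← hm, add_sub_cancel, h]
  have hlink : ∀ i, G.IsLink (g i).1.2 (g i).1.1 (g (i + 1)).1.1 := by
    intro i
    rw [hg1, (hr _).1]
    exact (hs _).2
  -- The edges at a vertex of the orbit are the next and the previous edge of the orbit.
  have hedge : ∀ i f y, G.IsLink f (g i).1.1 y →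
      (f = (g i).1.2 ∧ y = (g (i + 1)).1.1) ∨ (f = (g (i - 1)).1.2 ∧ y = (g (i - 1)).1.1) := by
    intro i f y hf
    let c : G.Dart := ⟨((g i).1.1, f), hf.inc_left⟩
    by_cases hc : c = g i
    · have hfi : f = (g i).1.2 := congrArg (fun d : G.Dart => d.1.2) hc
      subst hfi
      exact Or.inl ⟨rfl, hf.right_unique (hlink i)⟩
    · right
      have h1 := hr' (g i) c rfl hc
      have h2 : r (g i) = s (g (i - 1)) := by
        have := hg1 (i - 1)
        rw [sub_add_cancel] at this
        rw [this, hrr]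
      have h3 : f = (g (i - 1)).1.2 := by
        rw [← (hs (g (i - 1))).1, ← h2, ← h1]
      refine ⟨h3, ?_⟩
      have h4 := hlink (i - 1)
      rw [sub_add_cancel, ← h3] at h4
      exact hf.right_unique h4.symm
  have hrange : {w | G.Reachable x w} = Set.range fun i => (g i).1.1 := by
    ext w
    constructor
    · intro hw
      change Relation.ReflTransGen G.Adj x w at hw
      induction hw with
      | refl => exact ⟨0, by simp only [hg0]; rfl⟩
      | tail _ hab ih =>
        obtain ⟨i, rfl⟩ := ih
        obtain ⟨f, hf⟩ := hab
        rcases hedge i f _ hf with ⟨-, h⟩ | ⟨-, h⟩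
        exacts [⟨_, h.symm⟩, ⟨_, h.symm⟩]
    · rintro ⟨i, rfl⟩
      have h1 : ∀ n : ℕ, G.Reachable x (g n).1.1 := by
        intro n
        induction n with
        | zero =>
          rw [Nat.cast_zero, hg0]
          exact .refl
        | succ n ih =>
          rw [Nat.cast_succ]
          exact .tail ih ⟨_, hlink n⟩
      have := h1 i.val
      rwa [ZMod.natCast_zmod_val] at this
  have hlink' : ∀ i, (G.induce {w | G.Reachable x w}).IsLink (g i).1.2 (g i).1.1
      (g (i + 1)).1.1 := by
    intro i
    rw [induce_isLink, hrange]
    exact ⟨hlink i, ⟨i, rfl⟩, ⟨i + 1, rfl⟩⟩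
  refine ⟨k, hk, fun i => (g i).1.1, fun i => (g i).1.2, ?_, ?_, hrange, ?_, hlink'⟩
  · intro i j hij
    by_contra hne
    exact hgr i j (hr' (g i) (g j) hij.symm fun h => hne (hginj h).symm)
  · intro i j hij
    by_contra hne
    have h1 := hs' (g i) (g j) hij.symm fun h => hne (hginj h).symm
    refine hgr j (i + 1) ?_
    rw [h1, hg1]
  · ext f
    constructor
    · intro hf
      obtain ⟨a, b, hab⟩ := exists_isLink_of_mem_edgeSet hf
      rw [induce_isLink, hrange] at hab
      obtain ⟨hab, ⟨i, rfl⟩, -⟩ := hab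
      rcases hedge i f _ hab with ⟨h, -⟩ | ⟨h, -⟩
      exacts [⟨_, h.symm⟩, ⟨_, h.symm⟩]
    · rintro ⟨i, rfl⟩
      exact (hlink' i).edge_mem

/-! ### Cycle covers -/

/-- The connected component of `x` in `G`. -/
def component (G : Graph α β) (x : α) : Graph α β := G.induce {w | G.Reachable x w}

theorem Reachable.mem {x y : α} (h : G.Reachable x y) (hx : x ∈ G.vertexSet) :
    y ∈ G.vertexSet := by
  unfold Graph.Reachable at h
  induction h with
  | refl => exact hx
  | tail _ h _ => exact h.right_mem

theorem component_le {x : α} (hx : x ∈ G.vertexSet) : G.component x ≤ G :=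
  induce_le fun _ h => Reachable.mem h hx

theorem component_eq {x y : α} (h : G.Reachable x y) : G.component x = G.component y := by
  have : {w | G.Reachable x w} = {w | G.Reachable y w} :=
    Set.ext fun w => ⟨fun h' => .trans h.symm h', fun h' => .trans h h'⟩
  rw [component, component, this]

/-- A graph that becomes connected by adding the edges in `B` has at most `|B| + 1` components. -/
theorem ncard_component_le {F B : Set β} (hV : G.vertexSet.Finite) (hB : B.Finite)
    (h : (G.restrict (F ∪ B)).IsConnected) :
    ((G.restrict F).component '' G.vertexSet).ncard ≤ B.ncard + 1 := by
  set K := (G.restrict F).component '' G.vertexSet with hK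
  have hfinK : Finite K := (hV.image _).to_subtype
  let Q : SimpleGraph K :=
    { Adj := fun C D => C ≠ D ∧ ∃ b ∈ B, ∃ x y, G.IsLink b x y ∧
        s((C : Graph α β), (D : Graph α β)) =
          s((G.restrict F).component x, (G.restrict F).component y)
      symm := ⟨fun _ _ ⟨h1, b, hb, x, y, h2, h3⟩ =>
        ⟨h1.symm, b, hb, x, y, h2, Sym2.eq_swap.trans h3⟩⟩
      loopless := ⟨fun _ h => h.1 rfl⟩ }
  have hQ : Q.Connected := by
    obtain ⟨x₀, hx₀⟩ := h.1
    have : Nonempty K := ⟨⟨_, x₀, hx₀, rfl⟩⟩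
    refine ⟨?_⟩
    rintro ⟨_, x, hx, rfl⟩ ⟨_, y, hy, rfl⟩
    have hxy := h.2 x y hx hy
    unfold Graph.Reachable at hxy
    induction hxy with
    | refl => exact .refl _
    | @tail a b _ hab ih =>
      have ha : a ∈ G.vertexSet := hab.left_mem
      refine (ih ha).trans ?_
      by_cases heq : (G.restrict F).component a = (G.restrict F).component b
      · rw [show (⟨_, a, ha, rfl⟩ : K) = ⟨_, b, hy, rfl⟩ from Subtype.ext heq]
      · refine SimpleGraph.Adj.reachable ⟨fun h' => heq (congrArg Subtype.val h'), ?_⟩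
        obtain ⟨f, hf⟩ := hab
        rw [restrict_isLink] at hf
        rcases hf.1 with hfF | hfB
        · refine absurd (component_eq (.single ⟨f, ?_⟩)) heq
          rw [restrict_isLink]
          exact ⟨hfF, hf.2⟩
        · exact ⟨f, hfB, a, b, hf.2, rfl⟩
  have h1 := hQ.card_vert_le_card_edgeSet_add_one
  have hpick : ∀ z : Q.edgeSet, ∃ b ∈ B, ∃ x y, G.IsLink b x y ∧ z.1.map Subtype.val =
      s((G.restrict F).component x, (G.restrict F).component y) := by
    rintro ⟨z, hz⟩
    induction z with
    | _ C D => exact ((SimpleGraph.mem_edgeSet Q).1 hz).2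
  choose f hfB a b hlink hf using hpick
  have hinj : Function.Injective fun z => (⟨f z, hfB z⟩ : B) := by
    intro z w hzw
    have h2 : f z = f w := congrArg Subtype.val hzw
    have h3 : z.1.map Subtype.val = w.1.map Subtype.val := by
      rw [hf z, hf w]
      have h4 := hlink z
      rw [h2] at h4
      rcases h4.eq_and_eq_or_eq_and_eq (hlink w) with ⟨h5, h6⟩ | ⟨h5, h6⟩
      · rw [h5, h6]
      · rw [h5, h6, Sym2.eq_swap]
    exact Subtype.ext (Sym2.map.injective Subtype.val_injective h3)
  have hfinB : Finite B := hB.to_subtype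
  have h2 := Nat.card_le_card_of_injective _ hinj
  simp only [Nat.card_coe_set_eq] at h1 h2
  omega

/-- The components of a spanning 2-regular subgraph form a cycle cover. -/
theorem exists_isCycleCover [G.Loopless] (hV : G.vertexSet.Finite) (hE : G.edgeSet.Finite)
    {F B : Set β} (hF : F ⊆ G.edgeSet) (hB : B.Finite)
    (h2 : ∀ v ∈ G.vertexSet, {e | (G.restrict F).Inc e v}.ncard = 2)
    (h : (G.restrict (F ∪ B)).IsConnected) :
    ∃ 𝒞 : Finset (Graph α β), G.IsCycleCover 𝒞 ∧ (⋃ C ∈ 𝒞, C.edgeSet) = F ∧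
      𝒞.card ≤ B.ncard + 1 := by
  have hfin : ((G.restrict F).component '' G.vertexSet).Finite := hV.image _
  have : (G.restrict F).Loopless := ⟨fun e x he =>
    Loopless.not_isLoopAt e x (IsLink.mono restrict_le he)⟩
  have hmem : ∀ C, C ∈ hfin.toFinset ↔ ∃ x ∈ G.vertexSet, (G.restrict F).component x = C :=
    fun C => hfin.mem_toFinset
  refine ⟨hfin.toFinset, ⟨?_, ?_, ?_, ?_⟩, ?_, ?_⟩
  · intro C hC
    obtain ⟨x, hx, rfl⟩ := (hmem C).1 hC
    exact (component_le (G := G.restrict F) hx).trans restrict_le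
  · intro C hC
    obtain ⟨x, hx, rfl⟩ := (hmem C).1 hC
    exact isCycle_induce_reachable (G := G.restrict F) hV (hE.subset Set.inter_subset_left) h2 hx
  · intro C hC D hD hCD
    obtain ⟨x, hx, rfl⟩ := (hmem C).1 hC
    obtain ⟨y, hy, rfl⟩ := (hmem D).1 hD
    rw [Set.disjoint_left]
    intro z hz hz'
    exact hCD ((component_eq hz).trans (component_eq hz').symm)
  · intro v hv
    exact ⟨_, (hmem _).2 ⟨v, hv, rfl⟩, Relation.ReflTransGen.refl⟩
  · ext e
    simp only [Set.mem_iUnion]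
    constructor
    · rintro ⟨C, hC, he⟩
      obtain ⟨x, hx, rfl⟩ := (hmem C).1 hC
      exact ((component_le (G := G.restrict F) hx).edgeSet_mono he).2
    · intro he
      obtain ⟨x, y, hxy⟩ := exists_isLink_of_mem_edgeSet (hF he)
      have hxy' : (G.restrict F).IsLink e x y := by
        rw [restrict_isLink]
        exact ⟨he, hxy⟩
      refine ⟨_, (hmem _).2 ⟨x, hxy.left_mem, rfl⟩, ?_⟩
      have : ((G.restrict F).component x).IsLink e x y := by
        rw [component, induce_isLink]
        exact ⟨hxy', Relation.ReflTransGen.refl, .single hxy'.adj⟩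
      exact this.edge_mem
  · rw [← Set.ncard_eq_toFinset_card _ hfin]
    exact ncard_component_le hV hB h

/-! ### Cubic multigraphs -/

theorem IsCubic.finite_edgeSet (hV : G.vertexSet.Finite) (h : G.IsCubic) : G.edgeSet.Finite := by
  refine (hV.biUnion fun v hv => Set.finite_of_ncard_ne_zero (s := {e | G.Inc e v})
    (by rw [h v hv]; norm_num)).subset ?_
  intro e he
  obtain ⟨x, y, hxy⟩ := exists_isLink_of_mem_edgeSet he
  exact Set.mem_biUnion hxy.left_mem hxy.inc_left

open CubicCover in
/-- The perfect matching `M` and the set `N` of edges that the depth-first search cannot spare. As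
the constant weight `1 / 3` is a fractional perfect matching, `M` can be chosen to contain at most a
third of `N`. -/
theorem exists_matching_essential_edges [G.Loopless] (hfin : G.vertexSet.Finite)
    (hconn : G.IsConnected) (hbr : G.IsBridgeless) (hcub : G.IsCubic) :
    ∃ M N : Set β, G.IsPerfectMatching M ∧ 6 * (M ∩ N).ncard + 2 ≤ G.vertexSet.ncard ∧
      (G.restrict (G.edgeSet \ (M \ N))).IsConnected := by
  classical
  have hE := hcub.finite_edgeSet hfin
  have : Fintype G.vertexSet := hfin.fintype
  have : Fintype G.edgeSet := hE.fintype
  have : Nonempty G.vertexSet := hconn.1.to_subtype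
  have hends : ∀ e : G.edgeSet, ∃ x y : G.vertexSet, G.IsLink e x y := by
    rintro ⟨e, he⟩
    obtain ⟨x, y, hxy⟩ := exists_isLink_of_mem_edgeSet he
    exact ⟨⟨x, hxy.left_mem⟩, ⟨y, hxy.right_mem⟩, hxy⟩
  choose s t hst using hends
  have hlink : ∀ (e : G.edgeSet) (x y : G.vertexSet),
      G.IsLink e x y ↔ s(s e, t e) = s(x, y) := by
    intro e x y
    rw [(hst e).isLink_iff, Sym2.eq_iff, Subtype.ext_iff, Subtype.ext_iff, Subtype.ext_iff,
      Subtype.ext_iff]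
  have hinc : ∀ (v : G.vertexSet) (e : G.edgeSet), e ∈ cut s t {v} ↔ G.Inc e v := by
    intro v e
    rw [mem_cut_iff_exists]
    constructor
    · rintro ⟨a, ha, b, -, hab⟩
      rw [Finset.mem_singleton.1 ha] at hab
      exact ((hlink e v b).2 hab).inc_left
    · rintro ⟨w, hw⟩
      exact ⟨v, Finset.mem_singleton_self v, ⟨w, hw.right_mem⟩,
        fun h => hw.ne (congrArg Subtype.val (Finset.mem_singleton.1 h)).symm,
        (hlink e v ⟨w, hw.right_mem⟩).1 hw⟩
  have hcub' : ∀ v, (cut s t {v}).card = 3 := by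
    intro v
    have h1 : {e | G.Inc e v} = Subtype.val '' (cut s t {v} : Set G.edgeSet) := by
      ext e
      constructor
      · exact fun he => ⟨⟨e, he.edge_mem⟩, (hinc v ⟨e, he.edge_mem⟩).2 he, rfl⟩
      · rintro ⟨f, hf, rfl⟩
        exact (hinc v f).1 hf
    have h2 := hcub v v.2
    rwa [h1, Set.ncard_image_of_injective _ Subtype.val_injective, Set.ncard_coe_finset] at h2
  have hbr' : ∀ U, (cut s t U).card ≠ 1 := by
    intro U hU
    obtain ⟨e, he⟩ := Finset.card_eq_one.1 hU
    have heU : e ∈ cut s t U := by rw [he]; exact Finset.mem_singleton_self e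
    obtain ⟨a, ha, b, hb, hab⟩ := mem_cut_iff_exists.1 heU
    refine hbr e ⟨a, b, (hlink e a b).2 hab, fun hreach => hb ?_⟩
    -- Walks that avoid `e` stay in `U`.
    have hstay : ∀ y, (G.deleteEdges {(e : β)}).Reachable a y →
        ∃ hy : y ∈ G.vertexSet, (⟨y, hy⟩ : G.vertexSet) ∈ U := by
      intro y hy
      unfold Graph.Reachable at hy
      induction hy with
      | refl => exact ⟨a.2, ha⟩
      | tail _ hcd ih =>
        obtain ⟨hc, hcU⟩ := ih
        obtain ⟨f, hf⟩ := hcd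
        rw [deleteEdges_isLink] at hf
        obtain ⟨hf, hfe⟩ := hf
        refine ⟨hf.right_mem, ?_⟩
        by_contra hdU
        have : (⟨f, hf.edge_mem⟩ : G.edgeSet) ∈ cut s t U :=
          mem_cut_of_eq ((hlink ⟨f, hf.edge_mem⟩ ⟨_, hc⟩ ⟨_, hf.right_mem⟩).1 hf) hcU hdU
        rw [he, Finset.mem_singleton] at this
        exact hfe (congrArg Subtype.val this)
    exact (hstay b hreach).2
  have hconn' : ConnectedOn s t ∅ Finset.univ := by
    rintro ⟨a, ha⟩ - ⟨b, hb⟩ -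
    have h := hconn.2 a b ha hb
    unfold Graph.Reachable at h
    induction h with
    | refl => exact .refl
    | tail _ hcd ih =>
      obtain ⟨f, hf⟩ := id hcd
      exact .tail (ih hcd.left_mem) ⟨Finset.mem_univ _, Finset.mem_univ _,
        ⟨f, hf.edge_mem⟩, Finset.notMem_empty _,
        (hlink ⟨f, hf.edge_mem⟩ ⟨_, hf.left_mem⟩ ⟨_, hf.right_mem⟩).1 hf⟩
  have hthird : IsFracMatching Finset.univ s t fun _ => 1 / 3 := by
    refine ⟨fun _ => Finset.mem_univ _, fun _ => Finset.mem_univ _, fun _ => by norm_num,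
      fun e h => absurd (congrArg Subtype.val h) (hst e).ne, fun v _ => ?_, fun U _ hU => ?_⟩
    · simp [hcub' v]
    · have h1 : Odd (cut s t U).card := (odd_card_cut_iff hcub' U).2 hU
      have h2 := hbr' U
      obtain ⟨m, hm⟩ := h1
      have h3 : (3 : ℝ) ≤ (cut s t U).card := by
        exact_mod_cast show 3 ≤ (cut s t U).card by omega
      rw [Finset.sum_const, nsmul_eq_mul]
      linarith
  obtain ⟨N, hN, hNF⟩ := exists_essential_edges_univ hcub' hbr' hconn'
  obtain ⟨M, -, hM, hMc⟩ := hthird.hasCheapMatching fun e => if e ∈ N then 1 else 0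
  rw [sum_indicator_eq_card_inter, ← Finset.mul_sum, sum_indicator_eq_card_inter,
    Finset.univ_inter] at hMc
  have hMN : 3 * (M ∩ N).card ≤ N.card := by
    have : (3 : ℝ) * (M ∩ N).card ≤ N.card := by linarith
    exact_mod_cast this
  refine ⟨Subtype.val '' (M : Set G.edgeSet), Subtype.val '' (N : Set G.edgeSet), ⟨?_, ?_⟩, ?_,
    hconn.1, ?_⟩
  · rintro _ ⟨e, -, rfl⟩
    exact e.2
  · intro v hv
    obtain ⟨e, he⟩ := Finset.card_eq_one.1 (hM ⟨v, hv⟩ (Finset.mem_univ _))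
    have hmem : ∀ f, f ∈ cut s t {⟨v, hv⟩} ∩ M ↔ f = e := fun f => by
      rw [he, Finset.mem_singleton]
    have h1 := Finset.mem_inter.1 ((hmem e).2 rfl)
    refine ⟨e, ⟨⟨e, h1.2, rfl⟩, (hinc ⟨v, hv⟩ e).1 h1.1⟩, ?_⟩
    rintro _ ⟨⟨f, hf, rfl⟩, hfv⟩
    exact congrArg Subtype.val ((hmem f).1 (Finset.mem_inter.2 ⟨(hinc ⟨v, hv⟩ f).2 hfv, hf⟩))
  · rw [← Set.image_inter Subtype.val_injective, Set.ncard_image_of_injective _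
      Subtype.val_injective, ← Finset.coe_inter, Set.ncard_coe_finset,
      ← Nat.card_coe_set_eq, Nat.card_eq_fintype_card]
    omega
  · have h1 := hNF (M \ N) (fun u => by
      rw [← hM u (Finset.mem_univ u)]
      exact Finset.card_le_card (Finset.inter_subset_inter_left Finset.sdiff_subset))
      Finset.sdiff_disjoint
    intro x y hx hy
    have h2 := h1 ⟨x, hx⟩ (Finset.mem_univ _) ⟨y, hy⟩ (Finset.mem_univ _)
    refine Relation.ReflTransGen.lift Subtype.val ?_ _ _ h2
    rintro a b ⟨-, -, e, he, hab⟩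
    refine ⟨e, ?_⟩
    rw [restrict_isLink]
    refine ⟨⟨e.2, ?_⟩, (hlink e a b).2 hab⟩
    rintro ⟨⟨f, hf, hfe⟩, hfN⟩
    obtain rfl : f = e := Subtype.ext hfe
    exact he (Finset.mem_sdiff.2 ⟨hf, fun h => hfN ⟨f, h, rfl⟩⟩)

end Graph

theorem mainTheorem6 {α β : Type*} (G : Graph α β) (hloop : G.Loopless)
    (hfin : G.vertexSet.Finite) (hconn : G.IsConnected) (hbr : G.IsBridgeless)
    (hcub : G.IsCubic) :
    ∃ (M T : Set β) (𝒞 : Finset (Graph α β)),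
      G.IsPerfectMatching M ∧ G.IsSpanningTree T ∧
      ((M ∩ T).ncard : ℚ) ≤ (G.vertexSet.ncard : ℚ) / 6 - 1 / 3 ∧
      G.IsCycleCover 𝒞 ∧ (⋃ C ∈ 𝒞, C.edgeSet) = G.edgeSet \ M ∧
      𝒞.card ≤ ⌊(G.vertexSet.ncard : ℚ) / 6 + 2 / 3⌋₊ := by
  have hE := hcub.finite_edgeSet hfin
  obtain ⟨M, N, hM, hcard, hMN⟩ := G.exists_matching_essential_edges hfin hconn hbr hcub
  obtain ⟨T, hT, hTree⟩ := Graph.exists_isSpanningTree (hE.subset Set.sdiff_subset)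
    Set.sdiff_subset hMN
  have hfinMN : (M ∩ N).Finite := hE.subset (Set.inter_subset_left.trans hM.subset)
  have hunion : G.edgeSet \ (M \ N) = G.edgeSet \ M ∪ M ∩ N := by
    ext e
    have := @hM.subset e
    simp only [Set.mem_sdiff, Set.mem_union, Set.mem_inter_iff]
    tauto
  have hdeg : ∀ v ∈ G.vertexSet, {e | (G.restrict (G.edgeSet \ M)).Inc e v}.ncard = 2 := by
    intro v hv
    obtain ⟨m, ⟨hmM, hmv⟩, huniq⟩ := hM.existsUnique_inc v hv
    have h1 : {e | (G.restrict (G.edgeSet \ M)).Inc e v} = {e | G.Inc e v} \ {m} := by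
      ext e
      simp only [Graph.restrict_inc, Set.mem_ofPred_eq, Set.mem_sdiff, Set.mem_singleton_iff]
      constructor
      · rintro ⟨h2, -, h3⟩
        exact ⟨h2, fun h4 => h3 (h4 ▸ hmM)⟩
      · rintro ⟨h2, h3⟩
        exact ⟨h2, h2.edge_mem, fun h4 => h3 (huniq e ⟨h4, h2⟩)⟩
    rw [h1, Set.ncard_sdiff_singleton_of_mem (s := {e | G.Inc e v}) hmv, hcub v hv]
  obtain ⟨𝒞, h𝒞, hedges, h𝒞card⟩ := Graph.exists_isCycleCover hfin hE
    (Set.sdiff_subset (s := G.edgeSet) (t := M)) hfinMN hdeg (hunion ▸ hMN)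
  have hcardQ : (6 : ℚ) * (M ∩ N).ncard + 2 ≤ G.vertexSet.ncard := by exact_mod_cast hcard
  refine ⟨M, T, 𝒞, hM, hTree, ?_, h𝒞, hedges, Nat.le_floor ?_⟩
  · have hsub : M ∩ T ⊆ M ∩ N := fun e he =>
      ⟨he.1, by_contra fun h => (hT he.2).2 ⟨he.1, h⟩⟩
    have h1 : ((M ∩ T).ncard : ℚ) ≤ (M ∩ N).ncard := by
      exact_mod_cast Set.ncard_le_ncard hsub hfinMN
    linarith
  · have h1 : (𝒞.card : ℚ) ≤ (M ∩ N).ncard + 1 := by exact_mod_cast h𝒞card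
    linarith
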